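/- Let $M$ be a smooth ($C^\infty$, Hausdorff, second countable, boundaryless) manifold of finite dimension $n\ge 1$, with iterated tangent bundles $T^0M=M$, $T^{r+1}M=T(T^rM)$ and projections $\pi_r\colon T^{r+1}M\to T^rM$. Let $TM\setminus 0$ be the set of nonzero tangent vectors, and for $r\ge 1$ let $T^{r+1}M\setminus 0$ be the set of $\xi\in T^{r+1}M$ such that $D\pi_{T^rM\to M}(\xi)\in TM\setminus 0$. For a manifold $N$ let $\kappa\colon TTN\to TTN$ be the canonical involution, $\kappa(x,y,X,Y)=(x,X,y,Y)$ in induced coordinates; for $N=T^{r-2}M$ it is denoted by $\kappa_r$. Let $S$ be a spray on $M$, that is, a smooth vector field on $TM\setminus 0$ such that $D\pi_0\circ S=\mathrm{id}$ and $[E,S]=S$, where $E$ is the Liouville vector field $E(x,y)=(x,y,0,y)$. For a map $A\colon T^{r+1}M\setminus 0\to T^{r+2}M$ put $$A^c = D\kappa_{r+2}\circ\kappa_{r+3}\circ DA\circ\kappa_{r+2},$$ and let $S^{c}$ and $S^{cc}=(S^c)^c$ be the first and second complete lifts of $S$, which are sprays on $TM$ and on $TTM$. Intervals $I$ below are open,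 contain $0$, and may be unbounded. A geodesic of a spray $A$ on $T^rM$ is a smooth curve $\gamma\colon I\to T^rM$ with $\gamma'(t)\in T^{r+1}M\setminus 0$ and $\gamma''(t)=A(\gamma'(t))$ for all $t\in I$. A parallel Jacobi field is a curve $J\colon I\to TM$ of the form $J(t)=\alpha c'(t)+\beta t\,c'(t)$ with $\alpha,\beta\in\mathbb R$ and $c\colon I\to M$ a geodesic of $S$. Let $$\Delta=\{(\kappa_2\circ J')'(0) : J\colon(-\varepsilon,\varepsilon)\to TM \text{ a parallel Jacobi field},\ \varepsilon>0\}\subset TTTM,$$ and let $P$ be the sub-spray $(S^{cc},TTM,\Delta)$: a geodesic in $P$ is a geodesic $\gamma\colon I\to TTM$ of $S^{cc}$ with $\gamma'(t_0)\in\Delta$ for some $t_0\in I$. $P$ is called complete if every geodesic $I\to TTM$ in $P$ extends to a geodesic $\mathbb R\to TTM$ in $P$, and $S$ is called complete if every geodesic $I\to M$ of $S$ extends to a geodesic $\mathbb R\to M$ of $S$. **Proposition.** $P$ is complete if and only if $S$ is complete. -/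

import Mathlib

open Set Bundle
open scoped Manifold ContDiff

noncomputable section

namespace SprayGeometry

section General

variable {E : Type*} [NormedAddCommGroup E] [NormedSpace ℝ E]
  {H : Type*} [TopologicalSpace H] (I : ModelWithCorners ℝ E H)
  {N : Type*} [TopologicalSpace N] [ChartedSpace H N] [IsManifold I ∞ N]

/-- The canonical involution `κ : TTN → TTN`.

In Mathlib the fibre `TangentSpace I x` is the model space `E`, a vector being represented by its
components in the preferred chart of `N` at `x`. The preferred chart of `TN` at `⟨x, y⟩` is the
chart induced by the preferred chart of `N` at `x`. Hence the entries `x`, `y`, `(X, Y)` of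
`⟨⟨x, y⟩, (X, Y)⟩ : TTN` are its canonical induced coordinates (over the preferred chart at `x`),
and the involution is `κ (x, y, X, Y) = (x, X, y, Y)`. With `N = T^(r-2) M` this is `κ_r`. -/
def canonicalInvolution (ξ : TangentBundle I.tangent (TangentBundle I N)) :
    TangentBundle I.tangent (TangentBundle I N) :=
  let y : E := ξ.proj.2
  let XY : E × E := ξ.2
  ⟨⟨ξ.proj.proj, XY.1⟩, (y, XY.2)⟩

/-- The complete lift `S^c = Dκ ∘ κ ∘ DS ∘ κ` (a map `TTN → TTTN`) of a map `S : TN → TTN`.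
With `N = T^r M`, the four factors are `D κ_(r+2)`, `κ_(r+3)`, `D S` and `κ_(r+2)`. -/
def completeLift
    (S : TangentBundle I N → TangentBundle I.tangent (TangentBundle I N)) :
    TangentBundle I.tangent (TangentBundle I N) →
      TangentBundle I.tangent.tangent (TangentBundle I.tangent (TangentBundle I N)) :=
  fun ξ =>
    tangentMap I.tangent.tangent I.tangent.tangent (canonicalInvolution I (N := N))
      (canonicalInvolution I.tangent (N := TangentBundle I N)
        (tangentMap I.tangent I.tangent.tangent S (canonicalInvolution I ξ)))

/-- The tangent `γ' : ℝ → TN` of a curve `γ` in `N`. -/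
def velocity (γ : ℝ → N) : ℝ → TangentBundle I N :=
  fun t => ⟨γ t, mfderiv 𝓘(ℝ, ℝ) I γ t (1 : ℝ)⟩

/-- The Liouville vector field on `TN`, `E (x, y) = (x, y, 0, y)` in canonical coordinates, the
initial velocity of `s ↦ (1 + s) • v`. -/
def liouville (v : TangentBundle I N) : TangentSpace I.tangent v :=
  let y : E := v.2
  ((0, y) : E × E)

end General

/-- Open intervals of `ℝ` that contain `0`, possibly unbounded. -/
def IsOpenInterval (J : Set ℝ) : Prop :=
  IsOpen J ∧ J.OrdConnected ∧ (0 : ℝ) ∈ J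

section Iterated

/-! Here `N` plays the role of the iterated tangent bundle `T^r M` and `p : N → M` that of its
canonical projection (`p = id` if `r = 0`). -/

variable {E : Type*} [NormedAddCommGroup E] [NormedSpace ℝ E]
  {H : Type*} [TopologicalSpace H] (I : ModelWithCorners ℝ E H)
  {M : Type*} [TopologicalSpace M] [ChartedSpace H M]
  {E' : Type*} [NormedAddCommGroup E'] [NormedSpace ℝ E']
  {H' : Type*} [TopologicalSpace H'] (I' : ModelWithCorners ℝ E' H')
  {N : Type*} [TopologicalSpace N] [ChartedSpace H' N]

/-- The slashed tangent bundle `TN∖0 = {ξ ∈ TN : Dp (ξ) ≠ 0}`. For `p = id` it consists of the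
nonzero tangent vectors of `M`. -/
def slashed (p : N → M) : Set (TangentBundle I' N) :=
  {ξ | mfderiv I' I p ξ.proj ξ.2 ≠ 0}

variable [IsManifold I' ∞ N]

/-- The curve `γ`, restricted to the open interval `J`, is a geodesic of `S`: it is smooth and
regular, and `γ'' = S ∘ γ'`. -/
def IsGeodesicOn (p : N → M)
    (S : TangentBundle I' N → TangentBundle I'.tangent (TangentBundle I' N))
    (γ : ℝ → N) (J : Set ℝ) : Prop :=
  IsOpenInterval J ∧ ContMDiffOn 𝓘(ℝ, ℝ) I' ∞ γ J ∧
    (∀ t ∈ J, velocity I' γ t ∈ slashed I I' p) ∧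
    ∀ t ∈ J, velocity I'.tangent (velocity I' γ) t = S (velocity I' γ t)

/-- The curve `γ`, restricted to the open interval `J`, is a geodesic in `(S, N, Δ)`. -/
def IsSubSprayGeodesicOn (p : N → M)
    (S : TangentBundle I' N → TangentBundle I'.tangent (TangentBundle I' N))
    (Δ : Set (TangentBundle I' N)) (γ : ℝ → N) (J : Set ℝ) : Prop :=
  IsGeodesicOn I I' p S γ J ∧ ∃ t₀ ∈ J, velocity I' γ t₀ ∈ Δ

/-- `(S, N, Δ)` is complete: every geodesic on an open interval extends to a geodesic on `ℝ`. -/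
def IsCompleteSubSpray (p : N → M)
    (S : TangentBundle I' N → TangentBundle I'.tangent (TangentBundle I' N))
    (Δ : Set (TangentBundle I' N)) : Prop :=
  ∀ (J : Set ℝ) (γ : ℝ → N), IsSubSprayGeodesicOn I I' p S Δ γ J →
    ∃ γ₁ : ℝ → N, IsSubSprayGeodesicOn I I' p S Δ γ₁ univ ∧ EqOn γ₁ γ J

end Iterated

section Base

variable {E : Type*} [NormedAddCommGroup E] [NormedSpace ℝ E]
  {H : Type*} [TopologicalSpace H] (I : ModelWithCorners ℝ E H)
  {M : Type*} [TopologicalSpace M] [ChartedSpace H M] [IsManifold I ∞ M]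

/-- A vector field on `TM`, viewed as a map `TM → TTM`. -/
def toMap (S : (v : TangentBundle I M) → TangentSpace I.tangent v) :
    TangentBundle I M → TangentBundle I.tangent (TangentBundle I M) :=
  fun v => ⟨v, S v⟩

/-- `S` is a spray on `M`: a smooth vector field on `TM∖0` with `Dπ ∘ S = id` and `[E, S] = S` for
the Liouville vector field `E`. The values of `S` on the zero section are irrelevant. -/
structure IsSpray (S : (v : TangentBundle I M) → TangentSpace I.tangent v) : Prop where
  smooth : ContMDiffOn I.tangent I.tangent.tangent ∞ (toMap I S) (slashed I I (id : M → M))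
  tangentMap_proj : ∀ v ∈ slashed I I (id : M → M),
    tangentMap I.tangent I (TotalSpace.proj : TangentBundle I M → M) (toMap I S v) = v
  homogeneous : ∀ v ∈ slashed I I (id : M → M),
    VectorField.mlieBracket I.tangent (liouville I) S v = S v

/-- The curve `j` in `TM`, restricted to `J`, is a parallel Jacobi field
`j(t) = α c'(t) + β t c'(t)` for a geodesic `c : J → M` of `S`. -/
def IsParallelJacobiOn (S : (v : TangentBundle I M) → TangentSpace I.tangent v)
    (j : ℝ → TangentBundle I M) (J : Set ℝ) : Prop :=
  ∃ (α β : ℝ) (c : ℝ → M), IsGeodesicOn I I (id : M → M) (toMap I S) c J ∧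
    ∀ t ∈ J, j t = ⟨c t, α • (velocity I c t).2 + (β * t) • (velocity I c t).2⟩

/-- The set `Δ ⊆ TTTM` of all `(κ ∘ j')'(0)`, for parallel Jacobi fields `j : (-ε, ε) → TM`. -/
def parallelSemiDistribution (S : (v : TangentBundle I M) → TangentSpace I.tangent v) :
    Set (TangentBundle I.tangent.tangent (TangentBundle I.tangent (TangentBundle I M))) :=
  {ξ | ∃ (ε : ℝ) (j : ℝ → TangentBundle I M), 0 < ε ∧ IsParallelJacobiOn I S j (Ioo (-ε) ε) ∧
    velocity I.tangent.tangent (fun t => canonicalInvolution I (velocity I.tangent j t)) 0 = ξ}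

/-- Completeness of the spray `S` itself, that is, of `(S, M, TM)`. -/
def SprayIsComplete (S : (v : TangentBundle I M) → TangentSpace I.tangent v) : Prop :=
  IsCompleteSubSpray I I (id : M → M) (toMap I S) univ

/-- Completeness of `P = (S^cc, TTM, Δ)`. -/
def ParallelSubSprayIsComplete
    (S : (v : TangentBundle I M) → TangentSpace I.tangent v) : Prop :=
  IsCompleteSubSpray I I.tangent.tangent
    (fun ξ : TangentBundle I.tangent (TangentBundle I M) => ξ.proj.proj)
    (completeLift I.tangent (completeLift I (toMap I S)))
    (parallelSemiDistribution I S)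

end Base

end SprayGeometry

end

open Set Bundle Filter Topology
open scoped Manifold ContDiff

noncomputable section

namespace SprayGeometry

/-! Both implications rest on one construction: if `c` is a geodesic of `S` and `j = (α + β t) c'`,
then `κ ∘ j'` is a geodesic of `S^cc` over `c` (`IsParallelJacobiOn.isGeodesicOn`). If `P` is
complete, apply this to `j = c'`, extend the resulting geodesic of `P` to `ℝ`, and project it to
`M`; geodesics of `S^cc` project to geodesics of `S` (`IsGeodesicOn.footpoint_comp`). If `S` is
complete and a geodesic of `P` has velocity `(κ ∘ j')'(0)` at time `t₀`, extend the underlying `c`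
to `ℝ`. The same `α`, `β` then give a geodesic of `S^cc` on `ℝ`, which after a shift by `t₀` has the
prescribed velocity, so it agrees with the given one by uniqueness
(`eqOn_of_isGeodesicOn_completeLift`).

The construction is verified in coordinates. Write `S` as `x'' = F (x, x')`. A complete lift adjoins
the linearised equation (`SprayRep.completeLift`), so geodesics of `S^c` are Jacobi fields, and
`S^cc` linearises once more. The bracket condition `[E, S] = S` becomes Euler's identity `DF (0, y)
= 2 F` (`IsSpray.fderiv_force_eq`), which makes `t c'`, and not only `c'`, a Jacobi field.
Differentiating the Jacobi equation once more gives the equation of `S^cc` for `(u, u', y, y')`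
(`deriv_deriv_eq_liftRep_liftRep`).

Since `κ` is defined pointwise through preferred charts that vary with the base point, everything is
transferred to one fixed chart. There `κ` is the linear map `swapMid`, by symmetry of second
derivatives (`prolong_prolong_canonicalInvolution`). -/

theorem two_le_infty : (2 : ℕ∞ω) ≤ ∞ := by
  exact (WithTop.coe_le_coe.2 le_top : ((2 : ℕ∞) : ℕ∞ω) ≤ ∞)

/-! ### Vector valued maps and their prolongation to the tangent bundle -/

section Prolongation

variable {E : Type*} [NormedAddCommGroup E] [NormedSpace ℝ E]
  {H : Type*} [TopologicalSpace H] {I : ModelWithCorners ℝ E H}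
  {N : Type*} [TopologicalSpace N] [ChartedSpace H N]
  {V : Type*} [NormedAddCommGroup V] [NormedSpace ℝ V]

/-- The derivative of a vector valued map, as a map between the model vector spaces. -/
def vderiv (I : ModelWithCorners ℝ E H) (φ : N → V) (x : N) : E →L[ℝ] V :=
  mfderiv I 𝓘(ℝ, V) φ x

/-- The map `(x, y) ↦ (φ x, Dφ_x y)` induced on the tangent bundle by a vector valued map `φ`. -/
def prolong (I : ModelWithCorners ℝ E H) (φ : N → V) (ξ : TangentBundle I N) : V × V :=
  (φ ξ.proj, vderiv I φ ξ.proj ξ.2)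

/-- `mfderiv` at `x` is already computed in the preferred chart at `x`. Without boundary the model
range is the whole space, so the derivative within it is an ordinary one. -/
theorem vderiv_eq_fderiv [I.Boundaryless] {φ : N → V} {x : N}
    (hφ : MDifferentiableAt I 𝓘(ℝ, V) φ x) :
    vderiv I φ x = fderiv ℝ (φ ∘ (extChartAt I x).symm) (extChartAt I x x) := by
  have h : HasFDerivWithinAt (φ ∘ (extChartAt I x).symm) (vderiv I φ x) (range I)
      (extChartAt I x x) := hφ.hasMFDerivAt.2
  rw [I.range_eq_univ] at h
  exact (hasFDerivWithinAt_univ.1 h).fderiv.symm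

theorem vderiv_comp {E' : Type*} [NormedAddCommGroup E'] [NormedSpace ℝ E']
    {H' : Type*} [TopologicalSpace H'] {I' : ModelWithCorners ℝ E' H'}
    {N' : Type*} [TopologicalSpace N'] [ChartedSpace H' N'] {φ : N → V} {f : N' → N} {x : N'}
    (hφ : MDifferentiableAt I 𝓘(ℝ, V) φ (f x)) (hf : MDifferentiableAt I' I f x) (v : E') :
    vderiv I' (φ ∘ f) x v = vderiv I φ (f x) (mfderiv I' I f x v) :=
  mfderiv_comp_apply x hφ hf v

theorem prolong_tangentMap {E' : Type*} [NormedAddCommGroup E'] [NormedSpace ℝ E']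
    {H' : Type*} [TopologicalSpace H'] {I' : ModelWithCorners ℝ E' H'}
    {N' : Type*} [TopologicalSpace N'] [ChartedSpace H' N'] {φ : N → V} {f : N' → N}
    {ξ : TangentBundle I' N'}
    (hφ : MDifferentiableAt I 𝓘(ℝ, V) φ (f ξ.proj)) (hf : MDifferentiableAt I' I f ξ.proj) :
    prolong I φ (tangentMap I' I f ξ) = prolong I' (φ ∘ f) ξ :=
  Prod.ext rfl (vderiv_comp hφ hf ξ.2).symm

theorem vderiv_self {φ : E → V} {x : E} : vderiv 𝓘(ℝ, E) φ x = fderiv ℝ φ x :=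
  mfderiv_eq_fderiv

theorem vderiv_congr {φ φ' : N → V} {x : N} (h : φ =ᶠ[𝓝 x] φ') : vderiv I φ x = vderiv I φ' x :=
  h.mfderiv_eq

theorem vderiv_comp_left {W : Type*} [NormedAddCommGroup W] [NormedSpace ℝ W] {φ : N → V}
    {f : V → W} {x : N} (hf : DifferentiableAt ℝ f (φ x)) (hφ : MDifferentiableAt I 𝓘(ℝ, V) φ x)
    (v : E) : vderiv I (f ∘ φ) x v = fderiv ℝ f (φ x) (vderiv I φ x v) := by
  have := mfderiv_comp_apply x hf.mdifferentiableAt hφ v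
  rw [mfderiv_eq_fderiv] at this
  exact this

variable [IsManifold I ∞ N]

/-- The preferred charts of the tangent bundle are the differentials of those of the base, and the
model map `I.symm` contributes the identity as its derivative. -/
theorem extChartAt_tangent_symm_apply [I.Boundaryless] (p : TangentBundle I N) {u : E}
    (hu : u ∈ (extChartAt I p.proj).target) (w : E) :
    (extChartAt I.tangent p).symm (u, w) =
      tangentMap 𝓘(ℝ, E) I (extChartAt I p.proj).symm ⟨u, w⟩ := by
  have hu' : I.symm u ∈ (chartAt H p.proj).target := by
    rw [extChartAt_target] at hu; exact hu.1
  have h1 : HasMFDerivAt 𝓘(ℝ, E) I I.symm u (ContinuousLinearMap.id ℝ E) := by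
    have := I.hasMFDerivWithinAt_symm (x := u) (by simp [I.range_eq_univ])
    rw [I.range_eq_univ] at this
    exact hasMFDerivWithinAt_univ.1 this
  have h2 : tangentMap 𝓘(ℝ, E) I I.symm ⟨u, w⟩ = (⟨I.symm u, w⟩ : TangentBundle I H) := by
    simp only [tangentMap, h1.mfderiv]
    rfl
  have : IsManifold I 1 N := .of_le (n := ∞) (by simp)
  have h3 := tangentMap_chart_symm (I := I) (p := p) (q := ⟨I.symm u, w⟩) hu'
  have h4 : tangentMap 𝓘(ℝ, E) I ((chartAt H p.proj).symm ∘ I.symm) ⟨u, w⟩ =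
      tangentMap I I (chartAt H p.proj).symm (tangentMap 𝓘(ℝ, E) I I.symm ⟨u, w⟩) :=
    tangentMap_comp_at _ (mdifferentiableAt_atlas_symm (chart_mem_atlas _ _) hu')
      h1.mdifferentiableAt
  rw [h2, h3] at h4
  have h5 : ⇑(extChartAt I p.proj).symm = (chartAt H p.proj).symm ∘ I.symm := by
    simp [mfld_simps]
  rw [h5, h4]
  rfl

theorem extChartAt_tangent_self (p : TangentBundle I N) :
    extChartAt I.tangent p p = (extChartAt I p.proj p.proj, p.2) := by
  have : IsManifold I 1 N := .of_le (n := ∞) (by simp)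
  refine Prod.ext rfl ?_
  exact tangentCoordChange_self (I := I) (x := p.proj) (z := p.proj) (v := p.2)
    (mem_extChartAt_source p.proj)

theorem contMDiffOn_prolong {φ : N → V} {U : Set N} (hU : IsOpen U)
    (hφ : ContMDiffOn I 𝓘(ℝ, V) ∞ φ U) :
    ContMDiffOn I.tangent 𝓘(ℝ, V × V) ∞ (prolong I φ)
      (TotalSpace.proj ⁻¹' U : Set (TangentBundle I N)) := by
  have : IsManifold I 1 N := .of_le (n := ∞) (by simp)
  have h1 := hφ.contMDiffOn_tangentMapWithin (m := ∞) (by simp) hU.uniqueMDiffOn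
  have h2 := contMDiff_snd_tangentBundle_modelSpace (n := ∞) V 𝓘(ℝ, V)
  have h3 := h2.comp_contMDiffOn h1
  have h4 : ContMDiffOn I.tangent 𝓘(ℝ, V) ∞ (fun ξ : TangentBundle I N => φ ξ.proj)
      (TotalSpace.proj ⁻¹' U) :=
    hφ.comp (contMDiff_proj (TangentSpace I)).contMDiffOn subset_rfl
  refine (h4.prodMk_space h3).congr fun ξ hξ => Prod.ext rfl ?_
  exact congrArg (fun q : TangentBundle 𝓘(ℝ, V) V => (q.2 : V)) (tangentMapWithin_eq_tangentMap
    (hU.uniqueMDiffWithinAt hξ)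
    ((hφ.contMDiffAt (hU.mem_nhds hξ)).mdifferentiableAt (by simp))).symm

/-- `B` is the Hessian of `φ` in the preferred chart at `x`. It is the only obstruction to reading
entries of `TTN` off in a different chart, and its symmetry is what makes `κ` independent of the
chart. -/
theorem exists_vderiv_prolong_eq [I.Boundaryless] {φ : N → V} {U : Set N} (hU : IsOpen U)
    (hφ : ContMDiffOn I 𝓘(ℝ, V) ∞ φ U) {x : N} (hx : x ∈ U) :
    ∃ B : E →L[ℝ] E →L[ℝ] V, (∀ a b, B a b = B b a) ∧ ∀ y X Y : E,
      vderiv I.tangent (prolong I φ) ⟨x, y⟩ (X, Y) =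
        (vderiv I φ x X, B X y + vderiv I φ x Y) := by
  set e := extChartAt I x with he
  set Φ : E → V := φ ∘ e.symm with hΦ
  have : IsManifold I 1 N := .of_le (n := ∞) (by simp)
  have hd : ∀ z ∈ U, MDifferentiableAt I 𝓘(ℝ, V) φ z := fun z hz =>
    (hφ.contMDiffAt (hU.mem_nhds hz)).mdifferentiableAt (by simp)
  have htar : e.target ∈ 𝓝 (e x) := extChartAt_target_mem_nhds x
  have hsymm : ∀ u ∈ e.target, MDifferentiableAt 𝓘(ℝ, E) I e.symm u := fun u hu =>
    ((contMDiffOn_extChartAt_symm (n := ∞) x).contMDiffAt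
      ((isOpen_extChartAt_target x).mem_nhds hu)).mdifferentiableAt (by simp)
  have hΦs : ContDiffAt ℝ ∞ Φ (e x) := by
    have h : ContMDiffAt 𝓘(ℝ, E) 𝓘(ℝ, V) ∞ Φ (e x) := by
      refine ContMDiffAt.comp_of_eq (x := e x) (y := x) (hφ.contMDiffAt (hU.mem_nhds hx)) ?_
        (by simp [he])
      exact (contMDiffOn_extChartAt_symm x).contMDiffAt htar
    exact h.contDiffAt
  have hev : ∀ᶠ u in 𝓝 (e x), u ∈ e.target ∧ e.symm u ∈ U := by
    refine (eventually_mem_set.2 htar).and ?_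
    have h2 : Tendsto e.symm (𝓝 (e x)) (𝓝 x) := by
      have := (continuousAt_extChartAt_symm (I := I) x).tendsto
      simpa [he] using this
    exact h2.eventually (hU.mem_nhds hx)
  refine ⟨fderiv ℝ (fderiv ℝ Φ) (e x), fun a b => ?_, fun y X Y => ?_⟩
  · exact (hΦs.isSymmSndFDerivAt (by simpa using two_le_infty)).eq a b
  · have hP : MDifferentiableAt I.tangent 𝓘(ℝ, V × V) (prolong I φ)
        (⟨x, y⟩ : TangentBundle I N) :=
      ((contMDiffOn_prolong hU hφ).contMDiffAt ((hU.preimage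
        (FiberBundle.continuous_proj E (TangentSpace I))).mem_nhds hx)).mdifferentiableAt (by simp)
    -- In the induced chart the prolongation is `(u, w) ↦ (Φ u, DΦ_u w)`; its derivative at `(e x,
    -- y)` is then the product rule.
    have key : prolong I φ ∘ (extChartAt I.tangent (⟨x, y⟩ : TangentBundle I N)).symm
        =ᶠ[𝓝 (e x, y)] fun q : E × E => (Φ q.1, fderiv ℝ Φ q.1 q.2) := by
      have h1 : ∀ᶠ q : E × E in 𝓝 (e x, y), q.1 ∈ e.target ∧ e.symm q.1 ∈ U :=
        (continuous_fst.tendsto (e x, y)).eventually hev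
      filter_upwards [h1] with q hq
      have := extChartAt_tangent_symm_apply (⟨x, y⟩ : TangentBundle I N) (u := q.1) hq.1 q.2
      refine (congrArg (prolong I φ) this).trans ?_
      rw [prolong_tangentMap (hd _ hq.2) (hsymm _ hq.1)]
      exact Prod.ext rfl (by rw [← vderiv_self]; rfl)
    have h0 := vderiv_eq_fderiv hP
    rw [extChartAt_tangent_self] at h0
    replace h0 := h0.trans key.fderiv_eq
    rw [vderiv_eq_fderiv (hd x hx)]
    refine (congrArg (fun L : E × E →L[ℝ] V × V => L (X, Y)) h0).trans ?_
    have hd1 : HasFDerivAt Φ (fderiv ℝ Φ (e x)) (e x) :=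
      (hΦs.differentiableAt (by simp)).hasFDerivAt
    have hd2 : HasFDerivAt (fderiv ℝ Φ) (fderiv ℝ (fderiv ℝ Φ) (e x)) (e x) :=
      ((hΦs.fderiv_right (m := 1) (by simpa [one_add_one_eq_two] using two_le_infty)).differentiableAt (by simp)).hasFDerivAt
    have hf : HasFDerivAt (Prod.fst : E × E → E) (ContinuousLinearMap.fst ℝ E E) (e x, y) :=
      hasFDerivAt_fst
    have hs : HasFDerivAt (Prod.snd : E × E → E) (ContinuousLinearMap.snd ℝ E E) (e x, y) :=
      hasFDerivAt_snd
    have h3 := (HasFDerivAt.comp (e x, y) hd1 hf).prodMk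
      ((HasFDerivAt.comp (e x, y) hd2 hf).clm_apply hs)
    refine (congrArg (fun L : E × E →L[ℝ] V × V => L (X, Y)) h3.fderiv).trans ?_
    exact Prod.ext rfl (add_comm _ _)

end Prolongation

/-! ### Local coordinates on iterated tangent bundles and the canonical involution -/

section Coordinates

variable {E : Type*} [NormedAddCommGroup E] [NormedSpace ℝ E]
  {H : Type*} [TopologicalSpace H] {I : ModelWithCorners ℝ E H}
  {N : Type*} [TopologicalSpace N] [ChartedSpace H N]
  {V : Type*} [NormedAddCommGroup V] [NormedSpace ℝ V]

theorem tangentBundle_ext {ξ η : TangentBundle I N} (h1 : ξ.proj = η.proj)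
    (h2 : (ξ.2 : E) = (η.2 : E)) : ξ = η := by
  obtain ⟨x, y⟩ := ξ
  obtain ⟨x', y'⟩ := η
  obtain rfl : x = x' := h1
  exact congrArg (fun z : E => (⟨x, z⟩ : TangentBundle I N)) h2

theorem tangentMap_congr {E' : Type*} [NormedAddCommGroup E'] [NormedSpace ℝ E']
    {H' : Type*} [TopologicalSpace H'] {I' : ModelWithCorners ℝ E' H'}
    {N' : Type*} [TopologicalSpace N'] [ChartedSpace H' N'] {f g : N → N'} {ξ : TangentBundle I N}
    (h : f =ᶠ[𝓝 ξ.proj] g) : tangentMap I I' f ξ = tangentMap I I' g ξ :=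
  tangentBundle_ext h.self_of_nhds
    (congrArg (fun L : E →L[ℝ] E' => L ξ.2) (h.mfderiv_eq (I := I) (I' := I')))

/-- `φ : U → O` is a diffeomorphism onto an open subset of a vector space, with inverse `ψ`. -/
structure LocalCoord (I : ModelWithCorners ℝ E H) (φ : N → V) (ψ : V → N) (U : Set N)
    (O : Set V) : Prop where
  isOpen_source : IsOpen U
  isOpen_target : IsOpen O
  mapsTo : MapsTo φ U O
  mapsTo_symm : MapsTo ψ O U
  contMDiffOn : ContMDiffOn I 𝓘(ℝ, V) ∞ φ U
  contMDiffOn_symm : ContMDiffOn 𝓘(ℝ, V) I ∞ ψ O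
  left_inv : ∀ x ∈ U, ψ (φ x) = x
  right_inv : ∀ z ∈ O, φ (ψ z) = z

namespace LocalCoord

variable {φ : N → V} {ψ : V → N} {U : Set N} {O : Set V}

theorem contMDiffAt (h : LocalCoord I φ ψ U O) {x : N} (hx : x ∈ U) :
    ContMDiffAt I 𝓘(ℝ, V) ∞ φ x :=
  h.contMDiffOn.contMDiffAt (h.isOpen_source.mem_nhds hx)

theorem contMDiffAt_symm (h : LocalCoord I φ ψ U O) {z : V} (hz : z ∈ O) :
    ContMDiffAt 𝓘(ℝ, V) I ∞ ψ z :=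
  h.contMDiffOn_symm.contMDiffAt (h.isOpen_target.mem_nhds hz)

theorem mdifferentiableAt (h : LocalCoord I φ ψ U O) {x : N} (hx : x ∈ U) :
    MDifferentiableAt I 𝓘(ℝ, V) φ x :=
  (h.contMDiffAt hx).mdifferentiableAt (by simp)

theorem mdifferentiableAt_symm (h : LocalCoord I φ ψ U O) {z : V} (hz : z ∈ O) :
    MDifferentiableAt 𝓘(ℝ, V) I ψ z :=
  (h.contMDiffAt_symm hz).mdifferentiableAt (by simp)

theorem injOn (h : LocalCoord I φ ψ U O) : InjOn φ U := fun x hx y hy hxy => by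
  rw [← h.left_inv x hx, hxy, h.left_inv y hy]

/-- A map into the coordinate domain is smooth as soon as its coordinates are. -/
theorem contMDiffAt_of_comp (h : LocalCoord I φ ψ U O) {E' : Type*} [NormedAddCommGroup E']
    [NormedSpace ℝ E'] {H' : Type*} [TopologicalSpace H'] {I' : ModelWithCorners ℝ E' H'}
    {N' : Type*} [TopologicalSpace N'] [ChartedSpace H' N'] {f : N' → N} {g : N' → V} {x : N'}
    (hU : ∀ᶠ y in 𝓝 x, f y ∈ U) (hg : ∀ᶠ y in 𝓝 x, φ (f y) = g y)
    (hs : ContMDiffAt I' 𝓘(ℝ, V) ∞ g x) : ContMDiffAt I' I ∞ f x := by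
  have hx : g x ∈ O := hg.self_of_nhds ▸ h.mapsTo hU.self_of_nhds
  have h1 : ContMDiffAt I' I ∞ (ψ ∘ g) x := (h.contMDiffAt_symm hx).comp x hs
  refine h1.congr_of_eventuallyEq ?_
  filter_upwards [hU, hg] with y hy hy'
  rw [Function.comp_apply, ← hy', h.left_inv _ hy]

variable [IsManifold I ∞ N]

theorem extChartAt [I.Boundaryless] (x : N) :
    LocalCoord I (extChartAt I x) (extChartAt I x).symm (extChartAt I x).source
      (extChartAt I x).target where
  isOpen_source := isOpen_extChartAt_source x
  isOpen_target := isOpen_extChartAt_target x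
  mapsTo := (_root_.extChartAt I x).mapsTo
  mapsTo_symm := (_root_.extChartAt I x).mapsTo_symm
  contMDiffOn := by rw [extChartAt_source]; exact contMDiffOn_extChartAt
  contMDiffOn_symm := contMDiffOn_extChartAt_symm x
  left_inv := fun _ hz => (_root_.extChartAt I x).left_inv hz
  right_inv := fun _ hz => (_root_.extChartAt I x).right_inv hz

/-- Functoriality of the differential. Iterating it gives coordinates on `TN`, `TTN` and `TTTN` from
a single chart of `N`. -/
theorem prolong (h : LocalCoord I φ ψ U O) :
    LocalCoord I.tangent (prolong I φ)
      (fun q : V × V => tangentMap 𝓘(ℝ, V) I ψ ⟨q.1, q.2⟩)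
      (TotalSpace.proj ⁻¹' U : Set (TangentBundle I N)) (O ×ˢ univ) where
  isOpen_source := h.isOpen_source.preimage (FiberBundle.continuous_proj E (TangentSpace I))
  isOpen_target := h.isOpen_target.prod isOpen_univ
  mapsTo := fun _ hξ => ⟨h.mapsTo hξ, mem_univ _⟩
  mapsTo_symm := fun _ hq => h.mapsTo_symm hq.1
  contMDiffOn := contMDiffOn_prolong h.isOpen_source h.contMDiffOn
  contMDiffOn_symm := by
    have : IsManifold I 1 N := .of_le (n := ∞) (by simp)
    have h1 := h.contMDiffOn_symm.contMDiffOn_tangentMapWithin (m := ∞) (by simp)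
      h.isOpen_target.uniqueMDiffOn
    have h2 : ContMDiff 𝓘(ℝ, V × V) 𝓘(ℝ, V).tangent ∞
        (fun q : V × V => (⟨q.1, q.2⟩ : TangentBundle 𝓘(ℝ, V) V)) := fun q => by
      refine Bundle.contMDiffAt_totalSpace.2 ⟨contDiff_fst.contMDiff.contMDiffAt, ?_⟩
      simp only [trivializationAt_model_space_apply]
      exact contDiff_snd.contMDiff.contMDiffAt
    refine (h1.comp h2.contMDiffOn (s := O ×ˢ univ) fun q hq => hq.1).congr fun q hq => ?_
    exact (tangentMapWithin_eq_tangentMap (h.isOpen_target.uniqueMDiffWithinAt hq.1)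
      (h.mdifferentiableAt_symm hq.1)).symm
  left_inv := fun ξ hξ => by
    have h1 : (⟨(SprayGeometry.prolong I φ ξ).1, (SprayGeometry.prolong I φ ξ).2⟩ :
        TangentBundle 𝓘(ℝ, V) V) = tangentMap I 𝓘(ℝ, V) φ ξ := rfl
    rw [h1, ← tangentMap_comp_at ξ (h.mdifferentiableAt_symm (h.mapsTo hξ))
      (h.mdifferentiableAt hξ)]
    have h2 : ψ ∘ φ =ᶠ[𝓝 ξ.proj] id := by
      filter_upwards [h.isOpen_source.mem_nhds hξ] with y hy using h.left_inv y hy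
    rw [tangentMap_congr h2, tangentMap_id]
    rfl
  right_inv := fun q hq => by
    rw [prolong_tangentMap (h.mdifferentiableAt (h.mapsTo_symm hq.1))
      (h.mdifferentiableAt_symm hq.1)]
    have h2 : φ ∘ ψ =ᶠ[𝓝 q.1] id := by
      filter_upwards [h.isOpen_target.mem_nhds hq.1] with y hy using h.right_inv y hy
    refine Prod.ext h2.self_of_nhds ?_
    refine (congrArg (fun L : V →L[ℝ] V => L q.2) (vderiv_congr (I := 𝓘(ℝ, V)) h2)).trans ?_
    rw [vderiv_self, fderiv_id]
    rfl

theorem vderiv_injective (h : LocalCoord I φ ψ U O) {x : N} (hx : x ∈ U) {y z : E}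
    (hyz : vderiv I φ x y = vderiv I φ x z) : y = z := by
  have h1 : SprayGeometry.prolong I φ (⟨x, y⟩ : TangentBundle I N) =
    SprayGeometry.prolong I φ (⟨x, z⟩ : TangentBundle I N) := Prod.ext rfl hyz
  have := h.prolong.injOn (x₁ := (⟨x, y⟩ : TangentBundle I N)) hx (x₂ := ⟨x, z⟩) hx h1
  exact congrArg (fun ξ : TangentBundle I N => (ξ.2 : E)) this

end LocalCoord

/-- The interchange of the two middle entries. -/
def swapMid (V : Type*) [NormedAddCommGroup V] [NormedSpace ℝ V] :
    (V × V) × (V × V) →L[ℝ] (V × V) × (V × V) :=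
  ((ContinuousLinearMap.fst ℝ V V).prodMap (ContinuousLinearMap.fst ℝ V V)).prod
    ((ContinuousLinearMap.snd ℝ V V).prodMap (ContinuousLinearMap.snd ℝ V V))

@[simp]
theorem swapMid_apply (q : (V × V) × (V × V)) :
    swapMid V q = ((q.1.1, q.2.1), (q.1.2, q.2.2)) := rfl

variable [IsManifold I ∞ N] [I.Boundaryless]

/-- `κ` exchanges `X` and `y`, and the correction term `B X y` is unchanged by this because `B` is
symmetric. -/
theorem prolong_prolong_canonicalInvolution {φ : N → V} {U : Set N} (hU : IsOpen U)
    (hφ : ContMDiffOn I 𝓘(ℝ, V) ∞ φ U) {ξ : TangentBundle I.tangent (TangentBundle I N)}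
    (hξ : ξ.proj.proj ∈ U) :
    prolong I.tangent (prolong I φ) (canonicalInvolution I ξ) =
      swapMid V (prolong I.tangent (prolong I φ) ξ) := by
  obtain ⟨⟨x, y⟩, X, Y⟩ := ξ
  obtain ⟨B, hB, h⟩ := exists_vderiv_prolong_eq hU hφ hξ
  have h1 : prolong I.tangent (prolong I φ) (⟨⟨x, X⟩, (y, Y)⟩ : TangentBundle I.tangent
      (TangentBundle I N)) = ((φ x, vderiv I φ x X),
      (vderiv I φ x y, B y X + vderiv I φ x Y)) := Prod.ext rfl (h X y Y)
  refine Eq.trans h1 ?_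
  have h2 : prolong I.tangent (prolong I φ) (⟨⟨x, y⟩, (X, Y)⟩ : TangentBundle I.tangent
      (TangentBundle I N)) = ((φ x, vderiv I φ x y),
      (vderiv I φ x X, B X y + vderiv I φ x Y)) := Prod.ext rfl (h y X Y)
  refine Eq.trans ?_ (congrArg (swapMid V) h2).symm
  rw [swapMid_apply, hB y X]

theorem mfderiv_proj_apply (ξ : TangentBundle I.tangent (TangentBundle I N)) :
    (mfderiv I.tangent I (TotalSpace.proj : TangentBundle I N → N) ξ.proj ξ.2 : E) =
      (ξ.2 : E × E).1 := by
  obtain ⟨⟨x, y⟩, X, Y⟩ := ξ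
  have hc := LocalCoord.extChartAt (I := I) x
  have hx : x ∈ (extChartAt I x).source := mem_extChartAt_source x
  obtain ⟨B, hB, h⟩ := exists_vderiv_prolong_eq hc.isOpen_source hc.contMDiffOn hx
  refine hc.vderiv_injective hx ?_
  have hp : MDifferentiableAt I.tangent I (TotalSpace.proj : TangentBundle I N → N) ⟨x, y⟩ :=
    (contMDiff_proj (n := ∞) (TangentSpace I)).contMDiffAt.mdifferentiableAt (by simp)
  have h1 := vderiv_comp (I' := I.tangent) (f := (TotalSpace.proj : TangentBundle I N → N))
    (x := ⟨x, y⟩) (hc.mdifferentiableAt hx) hp (X, Y)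
  refine h1.symm.trans ?_
  have h2 := vderiv_comp_left (I := I.tangent) (φ := prolong I (extChartAt I x))
    (x := (⟨x, y⟩ : TangentBundle I N)) (f := (Prod.fst : E × E → E)) differentiableAt_fst
    (hc.prolong.mdifferentiableAt hx) (X, Y)
  refine h2.trans ?_
  rw [h y X Y, fderiv_fst]
  rfl

theorem canonicalInvolution_proj (ξ : TangentBundle I.tangent (TangentBundle I N)) :
    (canonicalInvolution I ξ).proj =
      tangentMap I.tangent I (TotalSpace.proj : TangentBundle I N → N) ξ :=
  tangentBundle_ext rfl (mfderiv_proj_apply ξ).symm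

/-- The definition of `κ` uses a chart depending on the point, so smoothness is not visible from it.
In a fixed chart `κ` is linear. -/
theorem contMDiff_canonicalInvolution :
    ContMDiff I.tangent.tangent I.tangent.tangent ∞ (canonicalInvolution I (N := N)) := by
  intro ξ
  have hc := LocalCoord.extChartAt (I := I) ξ.proj.proj
  have hU := hc.prolong.prolong.isOpen_source
  have hξ : ξ ∈ (TotalSpace.proj ⁻¹' (TotalSpace.proj ⁻¹' (extChartAt I ξ.proj.proj).source) :
    Set (TangentBundle I.tangent (TangentBundle I N))) := mem_extChartAt_source (I := I) ξ.proj.proj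
  have hev := hU.mem_nhds hξ
  refine hc.prolong.prolong.contMDiffAt_of_comp
    (g := swapMid E ∘ prolong I.tangent (prolong I (extChartAt I ξ.proj.proj))) ?_ ?_ ?_
  · filter_upwards [hev] with η hη using hη
  · filter_upwards [hev] with η hη
    exact prolong_prolong_canonicalInvolution hc.isOpen_source hc.contMDiffOn hη
  · exact (swapMid E).contDiff.contMDiff.contMDiffAt.comp ξ (hc.prolong.prolong.contMDiffAt hξ)

end Coordinates

/-! ### Velocities of curves in coordinates -/

section Curves

variable {E : Type*} [NormedAddCommGroup E] [NormedSpace ℝ E]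
  {H : Type*} [TopologicalSpace H] {I : ModelWithCorners ℝ E H}
  {N : Type*} [TopologicalSpace N] [ChartedSpace H N]
  {V : Type*} [NormedAddCommGroup V] [NormedSpace ℝ V]
  {φ : N → V} {ψ : V → N} {U : Set N} {O : Set V}

theorem prolong_velocity {γ : ℝ → N} {t : ℝ} (hφ : MDifferentiableAt I 𝓘(ℝ, V) φ (γ t))
    (hγ : MDifferentiableAt 𝓘(ℝ, ℝ) I γ t) :
    prolong I φ (velocity I γ t) = (φ (γ t), deriv (φ ∘ γ) t) := by
  refine Prod.ext rfl ?_
  refine (vderiv_comp (I' := 𝓘(ℝ, ℝ)) hφ hγ (1 : ℝ)).symm.trans ?_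
  rw [vderiv_self]
  exact fderiv_apply_one_eq_deriv

theorem LocalCoord.contDiffAt_comp (hc : LocalCoord I φ ψ U O) {γ : ℝ → N} {J : Set ℝ}
    (hJ : IsOpen J) (hγ : ContMDiffOn 𝓘(ℝ, ℝ) I ∞ γ J) {t : ℝ} (ht : t ∈ J) (hU : γ t ∈ U) :
    ContDiffAt ℝ ∞ (φ ∘ γ) t :=
  ((hc.contMDiffAt hU).comp t (hγ.contMDiffAt (hJ.mem_nhds ht))).contDiffAt

theorem LocalCoord.prolong_velocity (hc : LocalCoord I φ ψ U O) {γ : ℝ → N} {J : Set ℝ}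
    (hJ : IsOpen J) (hγ : ContMDiffOn 𝓘(ℝ, ℝ) I ∞ γ J) {t : ℝ} (ht : t ∈ J) (hU : γ t ∈ U) :
    SprayGeometry.prolong I φ (velocity I γ t) = (φ (γ t), deriv (φ ∘ γ) t) :=
  SprayGeometry.prolong_velocity (hc.mdifferentiableAt hU)
    ((hγ.contMDiffAt (hJ.mem_nhds ht)).mdifferentiableAt (by simp))

theorem eventually_mem_of_contMDiffOn {γ : ℝ → N} {J : Set ℝ}
    (hJ : IsOpen J) (hγ : ContMDiffOn 𝓘(ℝ, ℝ) I ∞ γ J) {t : ℝ} (ht : t ∈ J) (hU : U ∈ 𝓝 (γ t)) :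
    ∀ᶠ s in 𝓝 t, s ∈ J ∧ γ s ∈ U :=
  (eventually_mem_set.2 (hJ.mem_nhds ht)).and
    ((hγ.contMDiffAt (hJ.mem_nhds ht)).continuousAt.eventually hU)

end Curves

/-! ### Second order equations in coordinates and their complete lifts -/

section Representation

variable {E : Type*} [NormedAddCommGroup E] [NormedSpace ℝ E]
  {H : Type*} [TopologicalSpace H] {I : ModelWithCorners ℝ E H}
  {N : Type*} [TopologicalSpace N] [ChartedSpace H N] [IsManifold I ∞ N]
  {V : Type*} [NormedAddCommGroup V] [NormedSpace ℝ V]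
  {φ : N → V} {ψ : V → N} {U : Set N} {O : Set V}
  {S : TangentBundle I N → TangentBundle I.tangent (TangentBundle I N)}
  {F : V × V → V} {W : Set (TangentBundle I N)}

/-- In the coordinates `φ`, the map `S` is `(x, y) ↦ (x, y, y, F (x, y))` on the open set `W`. -/
structure SprayRep (I : ModelWithCorners ℝ E H) [IsManifold I ∞ N] (φ : N → V) (U : Set N)
    (S : TangentBundle I N → TangentBundle I.tangent (TangentBundle I N))
    (F : V × V → V) (W : Set (TangentBundle I N)) : Prop where
  isOpen : IsOpen W
  proj_mem : ∀ v ∈ W, v.proj ∈ U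
  contDiffAt : ∀ v ∈ W, ContDiffAt ℝ ∞ F (prolong I φ v)
  map_proj_mem : ∀ v ∈ W, (S v).proj.proj ∈ U
  eq : ∀ v ∈ W, prolong I.tangent (prolong I φ) (S v) =
    (prolong I φ v, ((prolong I φ v).2, F (prolong I φ v)))

/-- The second order right-hand side of the complete lift of `x'' = F (x, x')`. -/
def liftRep (F : V × V → V) (A : (V × V) × (V × V)) : V × V :=
  (F (swapMid V A).1, fderiv ℝ F (swapMid V A).1 (swapMid V A).2)

theorem contDiffAt_liftRep {A : (V × V) × (V × V)} (hF : ContDiffAt ℝ ∞ F (swapMid V A).1) :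
    ContDiffAt ℝ ∞ (liftRep F) A := by
  have h1 : ContDiffAt ℝ ∞ (fun A => (swapMid V A).1) A := (swapMid V).contDiff.fst.contDiffAt
  have h2 : ContDiffAt ℝ ∞ (fun A => (swapMid V A).2) A := (swapMid V).contDiff.snd.contDiffAt
  have h3 : ContDiffAt ℝ ∞ (fderiv ℝ F) (swapMid V A).1 := hF.fderiv_right (by simp)
  exact (hF.comp A h1).prodMk ((h3.comp A h1).clm_apply h2)

theorem SprayRep.contMDiffAt (hr : SprayRep I φ U S F W) (hc : LocalCoord I φ ψ U O)
    {v : TangentBundle I N} (hv : v ∈ W) : ContMDiffAt I.tangent I.tangent.tangent ∞ S v := by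
  have hW := hr.isOpen.mem_nhds hv
  refine hc.prolong.prolong.contMDiffAt_of_comp
    (g := (fun q : V × V => (q, (q.2, F q))) ∘ prolong I φ) ?_ ?_ ?_
  · filter_upwards [hW] with w hw using hr.map_proj_mem w hw
  · filter_upwards [hW] with w hw using hr.eq w hw
  · have h1 : ContDiffAt ℝ ∞ (fun q : V × V => (q, (q.2, F q))) (prolong I φ v) :=
      contDiffAt_id.prodMk (contDiffAt_snd.prodMk (hr.contDiffAt v hv))
    exact h1.contMDiffAt.comp v (hc.prolong.contMDiffAt (hr.proj_mem v hv))

/-- The four factors of `S^c` are followed through the coordinates: each `κ` swaps middle entries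
and `DS` differentiates `(x, y) ↦ (x, y, y, F)`. The domain is the set where `DS`, evaluated at `κ
ξ`, is based at a point of `W`. -/
theorem SprayRep.completeLift [I.Boundaryless] (hr : SprayRep I φ U S F W)
    (hc : LocalCoord I φ ψ U O) :
    SprayRep I.tangent (prolong I φ) (TotalSpace.proj ⁻¹' U) (completeLift I S) (liftRep F)
      {ξ | (canonicalInvolution I ξ).proj ∈ W} where
  isOpen := by
    have h1 : Continuous (canonicalInvolution I (N := N)) := contMDiff_canonicalInvolution.continuous
    exact hr.isOpen.preimage ((FiberBundle.continuous_proj (E × E) (TangentSpace I.tangent)).comp h1)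
  proj_mem := fun ξ hξ => hr.proj_mem (canonicalInvolution I ξ).proj hξ
  contDiffAt := fun ξ hξ => by
    have hξU : ξ.proj.proj ∈ U := hr.proj_mem (canonicalInvolution I ξ).proj hξ
    refine contDiffAt_liftRep ?_
    rw [← prolong_prolong_canonicalInvolution hc.isOpen_source hc.contMDiffOn hξU]
    exact hr.contDiffAt _ hξ
  map_proj_mem := fun ξ hξ => hr.map_proj_mem _ hξ
  eq := fun ξ hξ => by
    have hξU : ξ.proj.proj ∈ U := hr.proj_mem (canonicalInvolution I ξ).proj hξ
    set ζ := canonicalInvolution I ξ with hζ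
    have hκ : prolong I.tangent (prolong I φ) ζ = swapMid V (prolong I.tangent (prolong I φ) ξ) :=
      prolong_prolong_canonicalInvolution hc.isOpen_source hc.contMDiffOn hξU
    set a := prolong I φ ζ.proj with ha
    set b := vderiv I.tangent (prolong I φ) ζ.proj ζ.2 with hb
    have hab : prolong I.tangent (prolong I φ) ζ = (a, b) := rfl
    have hF := (hr.contDiffAt _ hξ).differentiableAt (by simp)
    -- the coordinates of `DS (ζ)`
    set η := tangentMap I.tangent I.tangent.tangent S ζ with hη
    have hηU : η.proj.proj.proj ∈ U := hr.map_proj_mem _ hξ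
    have h1 : prolong I.tangent.tangent (prolong I.tangent (prolong I φ)) η =
        ((a, (a.2, F a)), (b, (b.2, fderiv ℝ F a b))) := by
      rw [hη, prolong_tangentMap (hc.prolong.prolong.mdifferentiableAt (hr.map_proj_mem _ hξ))
        ((hr.contMDiffAt hc hξ).mdifferentiableAt (by simp))]
      have hev : prolong I.tangent (prolong I φ) ∘ S =ᶠ[𝓝 ζ.proj]
          (fun q : V × V => (q, (q.2, F q))) ∘ prolong I φ := by
        filter_upwards [hr.isOpen.mem_nhds hξ] with w hw using hr.eq w hw
      refine Prod.ext hev.self_of_nhds ?_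
      have hG : HasFDerivAt (fun q : V × V => (q, (q.2, F q)))
          ((ContinuousLinearMap.id ℝ (V × V)).prod
            ((ContinuousLinearMap.snd ℝ V V).prod (fderiv ℝ F a))) a :=
        (hasFDerivAt_id a).prodMk (hasFDerivAt_snd.prodMk hF.hasFDerivAt)
      change vderiv I.tangent (prolong I.tangent (prolong I φ) ∘ S) ζ.proj ζ.2 = _
      rw [vderiv_congr hev]
      refine (vderiv_comp_left (φ := prolong I φ) (x := ζ.proj) hG.differentiableAt
        (hc.prolong.mdifferentiableAt (hr.proj_mem _ hξ)) ζ.2).trans ?_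
      rw [← ha, hG.fderiv]
      rfl
    set θ := canonicalInvolution I.tangent η with hθ
    have h2 : prolong I.tangent.tangent (prolong I.tangent (prolong I φ)) θ =
        ((a, b), ((a.2, F a), (b.2, fderiv ℝ F a b))) := by
      rw [hθ, prolong_prolong_canonicalInvolution hc.prolong.isOpen_source hc.prolong.contMDiffOn
        hηU, h1]
      rfl
    have hθU : θ.proj.proj.proj ∈ U := hηU
    -- In coordinates `κ` is linear, hence its own derivative, so `Dκ` swaps the middle entries of
    -- the base point and of the vector separately.
    have h3 : prolong I.tangent.tangent (prolong I.tangent (prolong I φ))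
        (SprayGeometry.completeLift I S ξ) =
        (swapMid V (a, b), swapMid V ((a.2, F a), (b.2, fderiv ℝ F a b))) := by
      change prolong _ _ (tangentMap I.tangent.tangent I.tangent.tangent
        (canonicalInvolution I (N := N)) θ) = _
      rw [prolong_tangentMap (hc.prolong.prolong.mdifferentiableAt (x := canonicalInvolution I
        θ.proj) hθU) (contMDiff_canonicalInvolution.contMDiffAt.mdifferentiableAt (by simp))]
      have hev : prolong I.tangent (prolong I φ) ∘ canonicalInvolution I =ᶠ[𝓝 θ.proj]
          swapMid V ∘ prolong I.tangent (prolong I φ) := by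
        filter_upwards [hc.prolong.prolong.isOpen_source.mem_nhds hθU] with w hw
        exact prolong_prolong_canonicalInvolution hc.isOpen_source hc.contMDiffOn hw
      refine Prod.ext (hev.self_of_nhds.trans (congrArg (swapMid V) (congrArg Prod.fst h2))) ?_
      change vderiv I.tangent.tangent (prolong I.tangent (prolong I φ) ∘ canonicalInvolution I)
        θ.proj θ.2 = _
      rw [vderiv_congr hev]
      refine (vderiv_comp_left (φ := prolong I.tangent (prolong I φ)) (x := θ.proj)
        (swapMid V).differentiableAt (hc.prolong.prolong.mdifferentiableAt hθU) θ.2).trans ?_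
      rw [(swapMid V).fderiv]
      exact congrArg (swapMid V) (congrArg Prod.snd h2)
    have h4 : prolong I.tangent (prolong I φ) ξ = swapMid V (a, b) := by
      rw [← hab, hκ]; rfl
    rw [h3, h4]
    rfl

theorem contMDiffOn_velocity {γ : ℝ → N} {J : Set ℝ} (hJ : IsOpen J)
    (hγ : ContMDiffOn 𝓘(ℝ, ℝ) I ∞ γ J) : ContMDiffOn 𝓘(ℝ, ℝ) I.tangent ∞ (velocity I γ) J := by
  have : IsManifold I 1 N := .of_le (n := ∞) (by simp)
  have h1 := hγ.contMDiffOn_tangentMapWithin (m := ∞) (by simp) hJ.uniqueMDiffOn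
  have h2 : ContMDiff 𝓘(ℝ, ℝ) 𝓘(ℝ, ℝ).tangent ∞
      (fun t : ℝ => (⟨t, (1 : ℝ)⟩ : TangentBundle 𝓘(ℝ, ℝ) ℝ)) := fun t => by
    refine Bundle.contMDiffAt_totalSpace.2 ⟨contMDiff_id.contMDiffAt, ?_⟩
    simp only [trivializationAt_model_space_apply]
    exact contMDiff_const.contMDiffAt
  refine (h1.comp h2.contMDiffOn (s := J) fun t ht => ht).congr fun t ht => ?_
  exact (tangentMapWithin_eq_tangentMap (p := (⟨t, (1 : ℝ)⟩ : TangentBundle 𝓘(ℝ, ℝ) ℝ))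
    (hJ.uniqueMDiffWithinAt ht)
    ((hγ.contMDiffAt (hJ.mem_nhds ht)).mdifferentiableAt (by simp))).symm

theorem LocalCoord.prolong_velocity_velocity (hc : LocalCoord I φ ψ U O) {γ : ℝ → N} {J : Set ℝ}
    (hJ : IsOpen J) (hγ : ContMDiffOn 𝓘(ℝ, ℝ) I ∞ γ J) {t : ℝ} (ht : t ∈ J) (hU : γ t ∈ U) :
    SprayGeometry.prolong I.tangent (SprayGeometry.prolong I φ)
      (velocity I.tangent (velocity I γ) t) =
      ((φ (γ t), deriv (φ ∘ γ) t), (deriv (φ ∘ γ) t, deriv (deriv (φ ∘ γ)) t)) := by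
  have h1 := hc.prolong.prolong_velocity hJ (contMDiffOn_velocity hJ hγ) ht
    (show velocity I γ t ∈ TotalSpace.proj ⁻¹' U from hU)
  have hev : SprayGeometry.prolong I φ ∘ velocity I γ =ᶠ[𝓝 t]
      fun s => ((φ ∘ γ) s, deriv (φ ∘ γ) s) := by
    filter_upwards [eventually_mem_of_contMDiffOn hJ hγ ht (hc.isOpen_source.mem_nhds hU)] with s hs
    exact hc.prolong_velocity hJ hγ hs.1 hs.2
  have hu := hc.contDiffAt_comp hJ hγ ht hU
  have hu' : ContDiffAt ℝ ∞ (deriv (φ ∘ γ)) t := by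
    have : ContDiffAt ℝ ∞ (fun s => fderiv ℝ (φ ∘ γ) s 1) t :=
      (hu.fderiv_right (m := ∞) (by simp)).clm_apply contDiffAt_const
    exact this
  rw [h1, hev.deriv_eq, hc.prolong_velocity hJ hγ ht hU]
  exact Prod.ext rfl (((hu.differentiableAt (by simp)).hasDerivAt.prodMk
    (hu'.differentiableAt (by simp)).hasDerivAt).deriv)

/-- The geodesic equation in coordinates. -/
theorem SprayRep.velocity_velocity_eq_iff (hr : SprayRep I φ U S F W) (hc : LocalCoord I φ ψ U O)
    {γ : ℝ → N} {J : Set ℝ} (hJ : IsOpen J) (hγ : ContMDiffOn 𝓘(ℝ, ℝ) I ∞ γ J) {t : ℝ}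
    (ht : t ∈ J) (hW : velocity I γ t ∈ W) :
    velocity I.tangent (velocity I γ) t = S (velocity I γ t) ↔
      deriv (deriv (φ ∘ γ)) t = F (φ (γ t), deriv (φ ∘ γ) t) := by
  have hU : γ t ∈ U := hr.proj_mem _ hW
  have h1 := hc.prolong_velocity_velocity hJ hγ ht hU
  have h2 := hr.eq _ hW
  rw [hc.prolong_velocity hJ hγ ht hU] at h2
  constructor
  · intro h
    rw [← h, h1] at h2
    exact congrArg (fun q => q.2.2) h2
  · intro h
    refine hc.prolong.prolong.injOn hU (hr.map_proj_mem _ hW) ?_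
    rw [h1, h2, h]

end Representation

/-! ### The force term of a spray and Euler's identity -/

section Force

variable {E : Type*} [NormedAddCommGroup E] [NormedSpace ℝ E]
  {H : Type*} [TopologicalSpace H] {I : ModelWithCorners ℝ E H}
  {M : Type*} [TopologicalSpace M] [ChartedSpace H M]
  {V : Type*} [NormedAddCommGroup V] [NormedSpace ℝ V]
  {φ : M → V} {ψ : V → M} {U : Set M} {O : Set V}

theorem mem_slashed_id_iff {v : TangentBundle I M} :
    v ∈ slashed I I (id : M → M) ↔ (v.2 : E) ≠ 0 := by
  have h : mfderiv I I (id : M → M) v.proj v.2 = v.2 := by rw [mfderiv_id]; rfl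
  change mfderiv I I (id : M → M) v.proj v.2 ≠ 0 ↔ _
  rw [h]

/-- The inverse is the derivative of `ψ`, by the chain rule. Pullback of vector fields inverts the
derivative, so computing it requires this. -/
theorem LocalCoord.isInvertible_mfderiv (hc : LocalCoord I φ ψ U O) {x : M} (hx : x ∈ U) :
    (mfderiv I 𝓘(ℝ, V) φ x).IsInvertible := by
  have h1 := hc.mdifferentiableAt hx
  have h2 := hc.mdifferentiableAt_symm (hc.mapsTo hx)
  have h3 : ψ ∘ φ =ᶠ[𝓝 x] id := by
    filter_upwards [hc.isOpen_source.mem_nhds hx] with y hy using hc.left_inv y hy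
  have h4 : φ ∘ ψ =ᶠ[𝓝 (φ x)] id := by
    filter_upwards [hc.isOpen_target.mem_nhds (hc.mapsTo hx)] with y hy using hc.right_inv y hy
  have e1 : ∀ v : E, (mfderiv 𝓘(ℝ, V) I ψ (φ x) (mfderiv I 𝓘(ℝ, V) φ x v) : E) = v := fun v => by
    have h5 := mfderiv_comp_apply x h2 h1 v
    have h6 : (mfderiv I I (ψ ∘ φ) x v : E) = (mfderiv I I id x v : E) :=
      congrArg (fun L : E →L[ℝ] E => L v) h3.mfderiv_eq
    have h7 : (mfderiv I I id x v : E) = v := by rw [mfderiv_id]; rfl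
    exact h5.symm.trans (h6.trans h7)
  have e2 : ∀ v : V, (vderiv I φ x (mfderiv 𝓘(ℝ, V) I ψ (φ x) v)) = v := fun v => by
    have h5 : vderiv 𝓘(ℝ, V) (φ ∘ ψ) (φ x) v =
        vderiv I φ (ψ (φ x)) (mfderiv 𝓘(ℝ, V) I ψ (φ x) v) :=
      vderiv_comp (hc.mdifferentiableAt (hc.mapsTo_symm (hc.mapsTo hx))) h2 v
    rw [vderiv_congr h4, vderiv_self, fderiv_id, hc.left_inv x hx] at h5
    exact h5.symm
  let L : E →L[ℝ] V := vderiv I φ x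
  let L' : V →L[ℝ] E := mfderiv 𝓘(ℝ, V) I ψ (φ x)
  have : L.IsInvertible := ContinuousLinearMap.IsInvertible.of_inverse (g := L')
    (ContinuousLinearMap.ext e2) (ContinuousLinearMap.ext e1)
  exact this

variable [IsManifold I ∞ M] {S : (v : TangentBundle I M) → TangentSpace I.tangent v}

/-- The right-hand side `F` of the geodesic equation `x'' = F (x, x')` of `S` in coordinates. -/
def force (I : ModelWithCorners ℝ E H) [IsManifold I ∞ M]
    (S : (v : TangentBundle I M) → TangentSpace I.tangent v) (φ : M → V) (ψ : V → M)
    (q : V × V) : V :=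
  (prolong I.tangent (prolong I φ) (toMap I S (tangentMap 𝓘(ℝ, V) I ψ ⟨q.1, q.2⟩))).2.2

theorem LocalCoord.isOpen_slashed (hc : LocalCoord I φ ψ U O) :
    IsOpen {v : TangentBundle I M | v.proj ∈ U ∧ v ∈ slashed I I (id : M → M)} := by
  have h1 := hc.prolong.contMDiffOn.continuousOn.isOpen_inter_preimage hc.prolong.isOpen_source
    (isOpen_compl_singleton (x := (0 : V)).preimage continuous_snd)
  convert h1 using 1
  ext v
  refine and_congr_right fun hv => ?_
  rw [mem_slashed_id_iff]
  refine not_congr ⟨fun h => ?_, fun h => ?_⟩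
  · change vderiv I φ v.proj v.2 = 0
    exact (congrArg (vderiv I φ v.proj) h).trans (map_zero _)
  · refine hc.vderiv_injective hv (Eq.trans h ?_)
    exact (map_zero _).symm

/-- The condition `Dπ ∘ S = id` forces the third entry of `S` to equal `y`; the fourth entry is the
force by definition. -/
theorem IsSpray.sprayRep (hS : IsSpray I S) (hc : LocalCoord I φ ψ U O) :
    SprayRep I φ U (toMap I S) (force I S φ ψ)
      {v : TangentBundle I M | v.proj ∈ U ∧ v ∈ slashed I I (id : M → M)} where
  isOpen := hc.isOpen_slashed
  proj_mem := fun v hv => hv.1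
  contDiffAt := fun v hv => by
    have h1 : ContMDiffAt I.tangent I.tangent.tangent ∞ (toMap I S) v :=
      (hS.smooth.mono fun w hw => hw.2).contMDiffAt (hc.isOpen_slashed.mem_nhds hv)
    have h2 := hc.prolong.contMDiffAt_symm (hc.prolong.mapsTo hv.1)
    have h3 := hc.prolong.prolong.contMDiffAt (x := toMap I S v) hv.1
    have h4 := hc.prolong.left_inv v hv.1
    exact (((h3.comp v h1).comp_of_eq h2 h4).contDiffAt).snd.snd
  map_proj_mem := fun v hv => hv.1
  eq := fun v hv => by
    have h0 := hS.tangentMap_proj v hv.2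
    have h4 := hc.prolong.left_inv v hv.1
    have h5 : force I S φ ψ (prolong I φ v) =
        (prolong I.tangent (prolong I φ) (toMap I S v)).2.2 := by
      unfold force
      exact congrArg (fun w => (prolong I.tangent (prolong I φ) (toMap I S w)).2.2) h4
    have hp : MDifferentiableAt I.tangent I (TotalSpace.proj : TangentBundle I M → M) v :=
      (contMDiff_proj (n := ∞) (TangentSpace I)).contMDiffAt.mdifferentiableAt (by simp)
    refine Prod.ext rfl (Prod.ext ?_ h5.symm)
    have h6 := vderiv_comp_left (I := I.tangent) (φ := prolong I φ) (x := v)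
      (f := (Prod.fst : V × V → V)) differentiableAt_fst (hc.prolong.mdifferentiableAt hv.1) (S v)
    rw [fderiv_fst] at h6
    refine h6.symm.trans ?_
    have h7 := prolong_tangentMap (ξ := toMap I S v)
      (f := (TotalSpace.proj : TangentBundle I M → M)) (hc.mdifferentiableAt hv.1) hp
    rw [h0] at h7
    exact (congrArg Prod.snd h7).symm

/-- Euler's identity: the force is positively homogeneous of degree two, infinitesimally. -/
theorem IsSpray.fderiv_force_eq [I.Boundaryless] [CompleteSpace E] [CompleteSpace V]
    (hS : IsSpray I S) (hc : LocalCoord I φ ψ U O)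
    {v : TangentBundle I M} (hv : v.proj ∈ U ∧ v ∈ slashed I I (id : M → M)) :
    fderiv ℝ (force I S φ ψ) (prolong I φ v) (0, (prolong I φ v).2) =
      (2 : ℝ) • force I S φ ψ (prolong I φ v) := by
  have hr := hS.sprayRep hc
  set F := force I S φ ψ with hF
  set q := prolong I φ v with hq
  have hFq : DifferentiableAt ℝ F q := (hr.contDiffAt v hv).differentiableAt (by simp)
  -- `A` and `B` are the coordinate forms of the Liouville field and of `S`. Naturality of the Lie
  -- bracket under pullback then moves `[E, S] = S` to `V × V`.
  let A : (p : V × V) → TangentSpace 𝓘(ℝ, V × V) p := fun p => ((0, p.2) : V × V)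
  let B : (p : V × V) → TangentSpace 𝓘(ℝ, V × V) p := fun p => ((p.2, F p) : V × V)
  have hA : HasFDerivAt (fun p : V × V => ((0, p.2) : V × V))
      ((0 : V × V →L[ℝ] V).prod (ContinuousLinearMap.snd ℝ V V)) q :=
    (hasFDerivAt_const (0 : V) q).prodMk hasFDerivAt_snd
  have hB : HasFDerivAt (fun p : V × V => ((p.2, F p) : V × V))
      ((ContinuousLinearMap.snd ℝ V V).prod (fderiv ℝ F q)) q :=
    hasFDerivAt_snd.prodMk hFq.hasFDerivAt
  have hAs : ContMDiffAt 𝓘(ℝ, V × V) 𝓘(ℝ, V × V).tangent ∞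
      (fun p => (⟨p, A p⟩ : TangentBundle 𝓘(ℝ, V × V) (V × V))) q :=
    contMDiffAt_vectorSpace_iff_contDiffAt.2 (contDiffAt_const.prodMk contDiffAt_snd)
  have hBs : ContMDiffAt 𝓘(ℝ, V × V) 𝓘(ℝ, V × V).tangent ∞
      (fun p => (⟨p, B p⟩ : TangentBundle 𝓘(ℝ, V × V) (V × V))) q :=
    contMDiffAt_vectorSpace_iff_contDiffAt.2 (contDiffAt_snd.prodMk (hr.contDiffAt v hv))
  have hAL : ∀ᶠ w in 𝓝 v, VectorField.mpullback I.tangent 𝓘(ℝ, V × V) (prolong I φ) A w =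
      liouville I w := by
    filter_upwards [hr.isOpen.mem_nhds hv] with w hw
    rw [VectorField.mpullback_apply,
      (hc.prolong.isInvertible_mfderiv (x := w) hw.1).inverse_apply_eq]
    obtain ⟨B, -, h⟩ := exists_vderiv_prolong_eq hc.isOpen_source hc.contMDiffOn hw.1
    -- The Liouville field is vertical, so the Hessian term vanishes and its form is the same in
    -- every chart.
    have h' : ∀ y : E, vderiv I.tangent (prolong I φ) ⟨w.proj, y⟩ (0, y) =
        (0, vderiv I φ w.proj y) := fun y => (h y 0 y).trans (by simp)
    exact (h' w.2).symm
  have hBS : ∀ᶠ w in 𝓝 v, VectorField.mpullback I.tangent 𝓘(ℝ, V × V) (prolong I φ) B w =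
      S w := by
    filter_upwards [hr.isOpen.mem_nhds hv] with w hw
    rw [VectorField.mpullback_apply,
      (hc.prolong.isInvertible_mfderiv (x := w) hw.1).inverse_apply_eq]
    exact (congrArg Prod.snd (hr.eq w hw)).symm
  have : IsManifold I.tangent (minSmoothness ℝ 2) (TangentBundle I M) :=
    .of_le (n := ∞) (by simpa using two_le_infty)
  have key := VectorField.mpullback_mlieBracket (I := I.tangent) (I' := 𝓘(ℝ, V × V))
    (f := prolong I φ) (x₀ := v) (V := A) (W := B) (n := ∞)
    (hAs.mdifferentiableAt (by simp)) (hBs.mdifferentiableAt (by simp))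
    (hc.prolong.contMDiffAt hv.1) (by simpa using two_le_infty)
  rw [Filter.EventuallyEq.mlieBracket_vectorField_eq hAL hBS, hS.homogeneous v hv.2,
    VectorField.mpullback_apply,
    (hc.prolong.isInvertible_mfderiv (x := v) hv.1).inverse_apply_eq] at key
  have h1 : (VectorField.mlieBracket 𝓘(ℝ, V × V) A B q : V × V) = (q.2, F q) :=
    key.trans (congrArg Prod.snd (hr.eq v hv))
  have h2 : (VectorField.mlieBracket 𝓘(ℝ, V × V) A B q : V × V) =
      fderiv ℝ (fun p : V × V => ((p.2, F p) : V × V)) q (0, q.2) -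
        fderiv ℝ (fun p : V × V => ((0, p.2) : V × V)) q (q.2, F q) := by
    rw [← VectorField.mlieBracketWithin_univ, VectorField.mlieBracketWithin_eq_lieBracketWithin,
      VectorField.lieBracketWithin_univ]
    rfl
  rw [hA.fderiv, hB.fderiv] at h2
  -- The bracket `DB A - DA B` has second entry `DF (0, y) - F`, and homogeneity says that this
  -- equals `F`.
  have h3 := congrArg Prod.snd (h2.symm.trans h1)
  have h4 : fderiv ℝ F q (0, q.2) - F q = F q := h3
  rw [two_smul]
  exact sub_eq_iff_eq_add.1 h4

end Force

/-! ### Jacobi fields and uniqueness for `u'' = F (u, u')` in a vector space -/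

section Calculus

variable {V : Type*} [NormedAddCommGroup V] [NormedSpace ℝ V]
  {W : Type*} [NormedAddCommGroup W] [NormedSpace ℝ W] {F : V × V → V}

theorem contDiffAt_deriv {f : ℝ → V} {t : ℝ} (hf : ContDiffAt ℝ ∞ f t) :
    ContDiffAt ℝ ∞ (deriv f) t := by
  have : ContDiffAt ℝ ∞ (fun s => fderiv ℝ f s 1) t :=
    (hf.fderiv_right (m := ∞) (by simp)).clm_apply contDiffAt_const
  exact this

theorem eventually_differentiableAt {f : V → W} {t : V} (hf : ContDiffAt ℝ ∞ f t) :
    ∀ᶠ s in 𝓝 t, DifferentiableAt ℝ f s := by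
  filter_upwards [(hf.of_le (m := 1) (by simp)).eventually (by simp)] with s hs
    using hs.differentiableAt (by simp)

theorem eventually_hasDerivAt {f : ℝ → V} {t : ℝ} (hf : ContDiffAt ℝ ∞ f t) :
    ∀ᶠ s in 𝓝 t, HasDerivAt f (deriv f s) s :=
  (eventually_differentiableAt hf).mono fun _ hs => hs.hasDerivAt

theorem eventually_deriv_prodMk {f : ℝ → V} {g : ℝ → W} {t : ℝ} (hf : ContDiffAt ℝ ∞ f t)
    (hg : ContDiffAt ℝ ∞ g t) :
    deriv (fun s => (f s, g s)) =ᶠ[𝓝 t] fun s => (deriv f s, deriv g s) := by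
  filter_upwards [eventually_hasDerivAt hf, eventually_hasDerivAt hg] with s h1 h2
    using (h1.prodMk h2).deriv

theorem fderiv_liftRep {A : (V × V) × (V × V)} (hF : ContDiffAt ℝ ∞ F (swapMid V A).1)
    (B : (V × V) × (V × V)) :
    fderiv ℝ (liftRep F) A B = (fderiv ℝ F (swapMid V A).1 (swapMid V B).1,
      fderiv ℝ (fderiv ℝ F) (swapMid V A).1 (swapMid V B).1 (swapMid V A).2 +
        fderiv ℝ F (swapMid V A).1 (swapMid V B).2) := by
  have h1 : HasFDerivAt (fun A => (swapMid V A).1)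
      ((ContinuousLinearMap.fst ℝ _ _).comp (swapMid V)) A := (swapMid V).hasFDerivAt.fst
  have h2 : HasFDerivAt (fun A => (swapMid V A).2)
      ((ContinuousLinearMap.snd ℝ _ _).comp (swapMid V)) A := (swapMid V).hasFDerivAt.snd
  have h3 : HasFDerivAt F (fderiv ℝ F (swapMid V A).1) (swapMid V A).1 :=
    (hF.differentiableAt (by simp)).hasFDerivAt
  have h4 : HasFDerivAt (fderiv ℝ F) (fderiv ℝ (fderiv ℝ F) (swapMid V A).1) (swapMid V A).1 :=
    ((hF.fderiv_right (m := ∞) (by simp)).differentiableAt (by simp)).hasFDerivAt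
  have h5 := (HasFDerivAt.comp A h3 h1).prodMk ((HasFDerivAt.comp A h4 h1).clm_apply h2)
  refine (congrArg (fun L : (V × V) × (V × V) →L[ℝ] V × V => L B) h5.fderiv).trans ?_
  exact Prod.ext rfl (add_comm _ _)

/-- In coordinates: if `u'' = F (u, u')` with `F` homogeneous of degree two and
`y = (α + β t) u'`, then `(u, u', y, y')` solves the equation of the second complete lift. -/
theorem deriv_deriv_eq_liftRep_liftRep {u : ℝ → V} {t α β : ℝ} (hu : ContDiffAt ℝ ∞ u t)
    (hF : ContDiffAt ℝ ∞ F (u t, deriv u t))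
    (hg : ∀ᶠ s in 𝓝 t, deriv (deriv u) s = F (u s, deriv u s))
    (hE : ∀ᶠ s in 𝓝 t, fderiv ℝ F (u s, deriv u s) (0, deriv u s) =
      (2 : ℝ) • F (u s, deriv u s))
    {y : ℝ → V} (hy : ∀ᶠ s in 𝓝 t, y s = (α + β * s) • deriv u s)
    {a : ℝ → (V × V) × (V × V)} (ha : ∀ᶠ s in 𝓝 t, a s = ((u s, deriv u s), (y s, deriv y s))) :
    deriv (deriv a) t = liftRep (liftRep F) (a t, deriv a t) := by
  set k : ℝ → V × V := fun s => (u s, deriv u s) with hk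
  have hu1 := contDiffAt_deriv hu
  have hu2 := contDiffAt_deriv hu1
  have hu3 := contDiffAt_deriv hu2
  have hl : ContDiffAt ℝ ∞ (fun s : ℝ => α + β * s) t :=
    (contDiff_const.add (contDiff_const.mul contDiff_id)).contDiffAt
  have hys : ContDiffAt ℝ ∞ y t := (hl.smul hu1).congr_of_eventuallyEq hy
  have hy1s := contDiffAt_deriv hys
  have hy2s := contDiffAt_deriv hy1s
  have hks : ContDiffAt ℝ ∞ k t := hu.prodMk hu1
  have hk1 : deriv k =ᶠ[𝓝 t] fun s => (deriv u s, deriv (deriv u) s) :=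
    eventually_deriv_prodMk hu hu1
  have hsm : ∀ f : ℝ → V, ∀ s, DifferentiableAt ℝ f s →
      HasDerivAt (fun s => (α + β * s) • f s) ((α + β * s) • deriv f s + β • f s) s := by
    intro f s hf
    have : HasDerivAt (fun s : ℝ => α + β * s) β s := by
      simpa using ((hasDerivAt_id s).const_mul β).const_add α
    exact this.smul hf.hasDerivAt
  have hy1 : deriv y =ᶠ[𝓝 t] fun s => (α + β * s) • deriv (deriv u) s + β • deriv u s := by
    filter_upwards [EventuallyEq.deriv hy, eventually_differentiableAt hu1] with s h1 h2
    rw [h1, (hsm _ s h2).deriv]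
  have hy2 : deriv (deriv y) =ᶠ[𝓝 t] fun s => ((α + β * s) • deriv (deriv (deriv u)) s +
      β • deriv (deriv u) s) + β • deriv (deriv u) s := by
    filter_upwards [hy1.deriv, eventually_differentiableAt hu1, eventually_differentiableAt hu2]
      with s h1 h2 h3
    rw [h1]
    exact ((hsm _ s h3).add (h2.hasDerivAt.const_smul β)).deriv
  have hFk : ∀ᶠ s in 𝓝 t, DifferentiableAt ℝ F (k s) :=
    hks.continuousAt.eventually (eventually_differentiableAt hF)
  have hu3' : ∀ᶠ s in 𝓝 t, deriv (deriv (deriv u)) s =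
      fderiv ℝ F (k s) (deriv u s, deriv (deriv u) s) := by
    have h1 : deriv (deriv u) =ᶠ[𝓝 t] F ∘ k := hg
    filter_upwards [h1.deriv, hFk, eventually_differentiableAt hks, hk1] with s h2 h3 h4 h5
    rw [h2, ← h5]
    exact (h3.hasFDerivAt.comp_hasDerivAt s h4.hasDerivAt).deriv
  -- the Jacobi equation
  have hjac : ∀ᶠ s in 𝓝 t, deriv (deriv y) s = fderiv ℝ F (k s) (y s, deriv y s) := by
    filter_upwards [hy, hy1, hy2, hu3', hg, hE] with s e e1 e2 e3 e4 e5
    -- `DF` sends the first summand to `(α + β s) u'''`, by the differentiated geodesic equation,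
    -- and the second to `2 β u''`, by Euler's identity. The sum is `y''`.
    have h1 : (y s, deriv y s) = (α + β * s) • (deriv u s, deriv (deriv u) s) +
        β • ((0 : V), deriv u s) := by
      rw [e, e1]; simp
    rw [h1, map_add, map_smul, map_smul, ← e3, e5, e2, ← e4, add_assoc, two_smul, smul_add]
  have hjac1 : deriv (deriv (deriv y)) t =
      fderiv ℝ (fderiv ℝ F) (k t) (deriv u t, deriv (deriv u) t) (y t, deriv y t) +
        fderiv ℝ F (k t) (deriv y t, deriv (deriv y) t) := by
    have h1 : HasDerivAt (fun s => fderiv ℝ F (k s))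
        (fderiv ℝ (fderiv ℝ F) (k t) (deriv u t, deriv (deriv u) t)) t := by
      have h4 : HasFDerivAt (fderiv ℝ F) (fderiv ℝ (fderiv ℝ F) (k t)) (k t) :=
        ((hF.fderiv_right (m := ∞) (by simp)).differentiableAt (by simp)).hasFDerivAt
      have h5 : HasDerivAt k (deriv u t, deriv (deriv u) t) t :=
        (eventually_hasDerivAt hu).self_of_nhds.prodMk (eventually_hasDerivAt hu1).self_of_nhds
      exact h4.comp_hasDerivAt t h5
    have h2 : HasDerivAt (fun s => (y s, deriv y s)) (deriv y t, deriv (deriv y) t) t :=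
      (eventually_hasDerivAt hys).self_of_nhds.prodMk (eventually_hasDerivAt hy1s).self_of_nhds
    rw [EventuallyEq.deriv_eq hjac]
    exact (h1.clm_apply h2).deriv
  have ha1 : deriv a =ᶠ[𝓝 t] fun s =>
      ((deriv u s, deriv (deriv u) s), (deriv y s, deriv (deriv y) s)) := by
    filter_upwards [EventuallyEq.deriv ha, hk1, eventually_deriv_prodMk hys hy1s,
      eventually_deriv_prodMk hks (hys.prodMk hy1s)] with s h1 h2 h3 h4
    rw [h1, ← h2, ← h3]
    exact h4
  have ha2 : deriv (deriv a) t = ((deriv (deriv u) t, deriv (deriv (deriv u)) t),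
      (deriv (deriv y) t, deriv (deriv (deriv y)) t)) := by
    rw [ha1.deriv_eq]
    exact (((eventually_hasDerivAt hu1).self_of_nhds.prodMk
      (eventually_hasDerivAt hu2).self_of_nhds).prodMk
      ((eventually_hasDerivAt hy1s).self_of_nhds.prodMk
      (eventually_hasDerivAt hy2s).self_of_nhds)).deriv
  -- Differentiating the Jacobi equation along the curve puts `(u', u'')` first in `D²F`, while the
  -- double lift puts `(y, y')` first.
  have hsymm := (hF.isSymmSndFDerivAt (by simpa using two_le_infty)).eq
    (deriv u t, deriv (deriv u) t) (y t, deriv y t)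
  have h1 : liftRep (liftRep F) (a t, deriv a t) =
      (liftRep F ((u t, deriv u t), (deriv u t, deriv (deriv u) t)),
        fderiv ℝ (liftRep F) ((u t, deriv u t), (deriv u t, deriv (deriv u) t))
          ((y t, deriv y t), (deriv y t, deriv (deriv y) t))) := by
    rw [ha.self_of_nhds, ha1.self_of_nhds]
    rfl
  rw [ha2, h1, fderiv_liftRep hF, hjac1, hsymm, hjac.self_of_nhds, hu3'.self_of_nhds,
    hg.self_of_nhds]
  rfl

/-- Local uniqueness for second order equations. -/
theorem eventually_eq_of_deriv_deriv_eq {u v : ℝ → V} {t : ℝ}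
    (hF : ContDiffAt ℝ ∞ F (u t, deriv u t)) (hu : ContDiffAt ℝ ∞ u t) (hv : ContDiffAt ℝ ∞ v t)
    (hu' : ∀ᶠ s in 𝓝 t, deriv (deriv u) s = F (u s, deriv u s))
    (hv' : ∀ᶠ s in 𝓝 t, deriv (deriv v) s = F (v s, deriv v s))
    (h0 : u t = v t) (h1 : deriv u t = deriv v t) :
    ∀ᶠ s in 𝓝 t, u s = v s ∧ deriv u s = deriv v s := by
  -- Reduction to the first order system for `(u, u')`, whose right-hand side is `C¹` and hence
  -- locally Lipschitz.
  have hG : ContDiffAt ℝ 1 (fun q : V × V => (q.2, F q)) (u t, deriv u t) :=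
    contDiffAt_snd.prodMk (hF.of_le (by simp))
  obtain ⟨K, s, hs, hK⟩ := hG.exists_lipschitzOnWith
  have key : ∀ w : ℝ → V, ContDiffAt ℝ ∞ w t →
      (∀ᶠ s in 𝓝 t, deriv (deriv w) s = F (w s, deriv w s)) →
      (w t, deriv w t) = (u t, deriv u t) →
      ∀ᶠ r in 𝓝 t, HasDerivAt (fun s => (w s, deriv w s))
        ((fun q : V × V => (q.2, F q)) (w r, deriv w r)) r ∧ (w r, deriv w r) ∈ s := by
    intro w hw hw' hw0
    have hc : ContinuousAt (fun s => (w s, deriv w s)) t :=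
      (hw.prodMk (contDiffAt_deriv hw)).continuousAt
    have hs' : s ∈ 𝓝 (w t, deriv w t) := hw0 ▸ hs
    filter_upwards [hw', eventually_hasDerivAt hw, eventually_hasDerivAt (contDiffAt_deriv hw),
      hc.eventually (eventually_mem_set.2 hs')] with r e1 e2 e3 e4
    refine ⟨?_, e4⟩
    rw [← e1]
    exact e2.prodMk e3
  have := ODE_solution_unique_of_eventually (v := fun _ q => (q.2, F q)) (s := fun _ => s)
    (Eventually.of_forall fun _ => hK) (key u hu hu' rfl)
    (key v hv hv' (Prod.ext h0.symm h1.symm)) (Prod.ext h0 h1)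
  filter_upwards [this] with r hr using ⟨congrArg Prod.fst hr, congrArg Prod.snd hr⟩

end Calculus

theorem deriv_fst {V W : Type*} [NormedAddCommGroup V] [NormedSpace ℝ V] [NormedAddCommGroup W]
    [NormedSpace ℝ W] {b : ℝ → V × W} {s : ℝ} (hb : DifferentiableAt ℝ b s) :
    deriv (fun r => (b r).1) s = (deriv b s).1 :=
  ((ContinuousLinearMap.fst ℝ V W).hasFDerivAt.comp_hasDerivAt s hb.hasDerivAt).deriv

theorem deriv_snd {V W : Type*} [NormedAddCommGroup V] [NormedSpace ℝ V] [NormedAddCommGroup W]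
    [NormedSpace ℝ W] {b : ℝ → V × W} {s : ℝ} (hb : DifferentiableAt ℝ b s) :
    deriv (fun r => (b r).2) s = (deriv b s).2 :=
  ((ContinuousLinearMap.snd ℝ V W).hasFDerivAt.comp_hasDerivAt s hb.hasDerivAt).deriv

/-! ### Geodesics of the second complete lift: projection, construction, uniqueness -/

section Geodesics

variable {E : Type*} [NormedAddCommGroup E] [NormedSpace ℝ E]
  {H : Type*} [TopologicalSpace H] {I : ModelWithCorners ℝ E H}
  {M : Type*} [TopologicalSpace M] [ChartedSpace H M]

theorem velocity_comp {E' : Type*} [NormedAddCommGroup E'] [NormedSpace ℝ E']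
    {H' : Type*} [TopologicalSpace H'] {I' : ModelWithCorners ℝ E' H'}
    {N : Type*} [TopologicalSpace N] [ChartedSpace H' N] {p : N → M} {γ : ℝ → N} {t : ℝ}
    (hp : MDifferentiableAt I' I p (γ t)) (hγ : MDifferentiableAt 𝓘(ℝ, ℝ) I' γ t) :
    velocity I (p ∘ γ) t = tangentMap I' I p (velocity I' γ t) :=
  tangentBundle_ext rfl (mfderiv_comp_apply t hp hγ (1 : ℝ))

theorem velocity_congr {γ γ₁ : ℝ → M} {t : ℝ} (h : γ =ᶠ[𝓝 t] γ₁) :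
    velocity I γ t = velocity I γ₁ t :=
  tangentBundle_ext h.self_of_nhds (congrArg (fun L : ℝ →L[ℝ] E => L 1)
    (h.mfderiv_eq (I := 𝓘(ℝ, ℝ)) (I' := I)))

theorem velocity_eventuallyEq {γ γ₁ : ℝ → M} {t : ℝ} (h : γ =ᶠ[𝓝 t] γ₁) :
    velocity I γ =ᶠ[𝓝 t] velocity I γ₁ :=
  h.eventuallyEq_nhds.mono fun _ hs => velocity_congr hs

theorem velocity_comp_sub (γ : ℝ → M) {t a : ℝ}
    (hγ : MDifferentiableAt 𝓘(ℝ, ℝ) I γ (t - a)) :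
    velocity I (fun s => γ (s - a)) t = velocity I γ (t - a) := by
  have hd : HasDerivAt (fun s : ℝ => s - a) 1 t := (hasDerivAt_id t).sub_const a
  have h1 := velocity_comp (p := γ) (γ := fun s : ℝ => s - a) (t := t) (I' := 𝓘(ℝ, ℝ)) hγ
    hd.differentiableAt.mdifferentiableAt
  refine h1.trans (tangentBundle_ext rfl ?_)
  have h2 : (mfderiv 𝓘(ℝ, ℝ) 𝓘(ℝ, ℝ) (fun s : ℝ => s - a) t (1 : ℝ) : ℝ) = 1 := by
    rw [mfderiv_eq_fderiv]
    exact fderiv_apply_one_eq_deriv.trans hd.deriv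
  exact congrArg (fun r : ℝ => (mfderiv 𝓘(ℝ, ℝ) I γ (t - a) r : E)) h2

theorem mem_slashed_iff {E' : Type*} [NormedAddCommGroup E'] [NormedSpace ℝ E']
    {H' : Type*} [TopologicalSpace H'] {I' : ModelWithCorners ℝ E' H'}
    {N : Type*} [TopologicalSpace N] [ChartedSpace H' N] {p : N → M} {ξ : TangentBundle I' N} :
    ξ ∈ slashed I I' p ↔ tangentMap I' I p ξ ∈ slashed I I (id : M → M) :=
  (mem_slashed_id_iff (v := tangentMap I' I p ξ)).symm

variable [IsManifold I ∞ M]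

/-- The projection `TTM → M`. -/
abbrev footpoint (I : ModelWithCorners ℝ E H) {M : Type*} [TopologicalSpace M] [ChartedSpace H M]
    [IsManifold I ∞ M] : TangentBundle I.tangent (TangentBundle I M) → M :=
  fun ξ => ξ.proj.proj

theorem mdifferentiableAt_proj (v : TangentBundle I M) :
    MDifferentiableAt I.tangent I (TotalSpace.proj : TangentBundle I M → M) v :=
  (contMDiff_proj (n := ∞) (TangentSpace I)).contMDiffAt.mdifferentiableAt (by simp)

theorem contMDiff_footpoint : ContMDiff I.tangent.tangent I ∞ (footpoint I (M := M)) :=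
  (contMDiff_proj (n := ∞) (TangentSpace I)).comp
    (contMDiff_proj (n := ∞) (TangentSpace I.tangent (M := TangentBundle I M)))

theorem velocity_footpoint_mem_slashed_iff {γ : ℝ → TangentBundle I.tangent (TangentBundle I M)}
    {t : ℝ} (hγ : MDifferentiableAt 𝓘(ℝ, ℝ) I.tangent.tangent γ t) :
    velocity I.tangent.tangent γ t ∈ slashed I I.tangent.tangent (footpoint I (M := M)) ↔
      velocity I (footpoint I ∘ γ) t ∈ slashed I I (id : M → M) := by
  rw [mem_slashed_iff, velocity_comp (contMDiff_footpoint.contMDiffAt.mdifferentiableAt (by simp))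
    hγ]

variable [I.Boundaryless] {V : Type*} [NormedAddCommGroup V] [NormedSpace ℝ V]
  {φ : M → V} {ψ : V → M} {U : Set M} {O : Set V}
  {S : (v : TangentBundle I M) → TangentSpace I.tangent v}

/-- The second complete lift of a spray in coordinates. -/
theorem IsSpray.sprayRep_completeLift_completeLift (hS : IsSpray I S)
    (hc : LocalCoord I φ ψ U O) :
    SprayRep I.tangent.tangent (prolong I.tangent (prolong I φ)) (footpoint I ⁻¹' U)
      (completeLift I.tangent (completeLift I (toMap I S)))
      (liftRep (liftRep (force I S φ ψ)))
      {ξ | ξ.proj.proj.proj ∈ U ∧ ξ ∈ slashed I I.tangent.tangent (footpoint I)} := by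
  have h := ((hS.sprayRep hc).completeLift hc).completeLift hc.prolong
  suffices hset : {ξ | ξ.proj.proj.proj ∈ U ∧ ξ ∈ slashed I I.tangent.tangent (footpoint I (M := M))} =
      {ξ | (canonicalInvolution I.tangent (N := TangentBundle I M) ξ).proj ∈
        {ξ | (canonicalInvolution I (N := M) ξ).proj ∈
          {v : TangentBundle I M | v.proj ∈ U ∧ v ∈ slashed I I (id : M → M)}}} by
    rw [hset]
    exact h
  ext ξ
  refine and_congr_right fun _ => ?_
  -- The base point of `κ ξ` is `Dπ ξ`, so two passages through `κ` give the differential of `TTM →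
  -- M`, and the iterated domain is exactly the slashed bundle.
  rw [mem_slashed_iff, canonicalInvolution_proj, canonicalInvolution_proj]
  have : tangentMap I.tangent.tangent I (footpoint I (M := M)) ξ = _ :=
    tangentMap_comp_at ξ (mdifferentiableAt_proj (I := I) ξ.proj.proj)
      (mdifferentiableAt_proj (I := I.tangent) ξ.proj)
  rw [this]

/-- Geodesics of the second complete lift project to geodesics. -/
theorem IsGeodesicOn.footpoint_comp (hS : IsSpray I S)
    {γ : ℝ → TangentBundle I.tangent (TangentBundle I M)} {J : Set ℝ}
    (hγ : IsGeodesicOn I I.tangent.tangent (footpoint I)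
      (completeLift I.tangent (completeLift I (toMap I S))) γ J) :
    IsGeodesicOn I I (id : M → M) (toMap I S) (footpoint I ∘ γ) J := by
  obtain ⟨hJ, hs, hreg, heq⟩ := hγ
  have hsp : ContMDiffOn 𝓘(ℝ, ℝ) I ∞ (footpoint I ∘ γ) J :=
    contMDiff_footpoint.comp_contMDiffOn hs
  have hd : ∀ t ∈ J, MDifferentiableAt 𝓘(ℝ, ℝ) I.tangent.tangent γ t := fun t ht =>
    (hs.contMDiffAt (hJ.1.mem_nhds ht)).mdifferentiableAt (by simp)
  have hreg' : ∀ t ∈ J, velocity I (footpoint I ∘ γ) t ∈ slashed I I (id : M → M) := fun t ht =>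
    (velocity_footpoint_mem_slashed_iff (hd t ht)).1 (hreg t ht)
  refine ⟨hJ, hsp, hreg', fun t ht => ?_⟩
  have hc := LocalCoord.extChartAt (I := I) (footpoint I (γ t))
  have hU : footpoint I (γ t) ∈ (extChartAt I (footpoint I (γ t))).source :=
    mem_extChartAt_source _
  set φ := extChartAt I (footpoint I (γ t)) with hφ
  rw [(hS.sprayRep hc).velocity_velocity_eq_iff hc hJ.1 hsp ht ⟨hU, hreg' t ht⟩]
  have h := ((hS.sprayRep_completeLift_completeLift hc).velocity_velocity_eq_iff
    hc.prolong.prolong hJ.1 hs ht ⟨hU, hreg t ht⟩).1 (heq t ht)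
  set a := prolong I.tangent (prolong I φ) ∘ γ with ha
  have hev : ∀ᶠ s in 𝓝 t, ContDiffAt ℝ ∞ a s := by
    filter_upwards [eventually_mem_of_contMDiffOn hJ.1 hs ht
      (hc.prolong.prolong.isOpen_source.mem_nhds hU)] with s hs'
    exact hc.prolong.prolong.contDiffAt_comp hJ.1 hs hs'.1 hs'.2
  -- The lowest of the four entries of the lifted system satisfies the original equation; it remains
  -- to commute taking this entry with differentiation.
  have hfst : ∀ (b : ℝ → (E × E) × (E × E)) (s : ℝ), ContDiffAt ℝ ∞ b s →
      deriv (fun r => (b r).1.1) s = (deriv b s).1.1 := fun b s hb =>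
    (deriv_fst (b := fun r => (b r).1) (hb.fst.differentiableAt (by simp))).trans
      (congrArg Prod.fst (deriv_fst (hb.differentiableAt (by simp))))
  have e1 : deriv (φ ∘ footpoint I ∘ γ) =ᶠ[𝓝 t] fun s => (deriv a s).1.1 :=
    hev.mono fun s hs' => hfst a s hs'
  rw [e1.deriv_eq, hfst _ _ (contDiffAt_deriv hev.self_of_nhds), h, e1.self_of_nhds]
  rfl

/-- For a parallel Jacobi field `j`, the curve `κ ∘ j'` is a geodesic of the second complete
lift. -/
theorem IsParallelJacobiOn.isGeodesicOn [CompleteSpace E] (hS : IsSpray I S)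
    {α β : ℝ} {c : ℝ → M} {j : ℝ → TangentBundle I M} {J : Set ℝ}
    (hcJ : IsGeodesicOn I I (id : M → M) (toMap I S) c J)
    (hj : ∀ t ∈ J, j t = ⟨c t, α • (velocity I c t).2 + (β * t) • (velocity I c t).2⟩) :
    IsGeodesicOn I I.tangent.tangent (footpoint I)
      (completeLift I.tangent (completeLift I (toMap I S)))
      (fun t => canonicalInvolution I (velocity I.tangent j t)) J := by
  obtain ⟨hJ, hs, hreg, heq⟩ := hcJ
  have hloc : ∀ t ∈ J, ∀ᶠ s in 𝓝 t, s ∈ J ∧ c s ∈ (extChartAt I (c t)).source ∧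
      prolong I (extChartAt I (c t)) (j s) = ((extChartAt I (c t) ∘ c) s,
        (α + β * s) • deriv (extChartAt I (c t) ∘ c) s) := fun t ht => by
    have hc := LocalCoord.extChartAt (I := I) (c t)
    filter_upwards [eventually_mem_of_contMDiffOn hJ.1 hs ht
      (hc.isOpen_source.mem_nhds (mem_extChartAt_source (c t)))] with s hs'
    refine ⟨hs'.1, hs'.2, ?_⟩
    have h1 := congrArg Prod.snd (hc.prolong_velocity hJ.1 hs hs'.1 hs'.2)
    have h2 : vderiv I (extChartAt I (c t)) (c s) (velocity I c s).2 =
      deriv (extChartAt I (c t) ∘ c) s := h1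
    rw [hj s hs'.1]
    refine Prod.ext rfl ?_
    have h3 : ∀ y : E, vderiv I (extChartAt I (c t)) (c s) (α • y + (β * s) • y) =
        (α + β * s) • vderiv I (extChartAt I (c t)) (c s) y := fun y => by
      rw [← add_smul, map_smul]
    exact (h3 _).trans (congrArg ((α + β * s) • ·) h2)
  have hjs : ContMDiffOn 𝓘(ℝ, ℝ) I.tangent ∞ j J := fun t ht => by
    have hc := LocalCoord.extChartAt (I := I) (c t)
    have hu := hc.contDiffAt_comp hJ.1 hs ht (mem_extChartAt_source (c t))
    have hl : ContDiffAt ℝ ∞ (fun s : ℝ => α + β * s) t :=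
      (contDiff_const.add (contDiff_const.mul contDiff_id)).contDiffAt
    refine (hc.prolong.contMDiffAt_of_comp (I' := 𝓘(ℝ, ℝ)) (x := t) (f := j) ?_
      ((hloc t ht).mono fun s hs' => hs'.2.2)
      (hu.prodMk (hl.smul (contDiffAt_deriv hu))).contMDiffAt).contMDiffWithinAt
    filter_upwards [hloc t ht] with s hs'
    rw [hj s hs'.1]
    exact hs'.2.1
  set γ := fun t => canonicalInvolution I (velocity I.tangent j t) with hγ
  have hγs : ContMDiffOn 𝓘(ℝ, ℝ) I.tangent.tangent ∞ γ J :=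
    contMDiff_canonicalInvolution.comp_contMDiffOn (contMDiffOn_velocity hJ.1 hjs)
  have hpγ : ∀ s ∈ J, footpoint I (γ s) = c s := fun s hs' => by
    change (j s).proj = c s
    rw [hj s hs']
  have hreg' : ∀ t ∈ J, velocity I.tangent.tangent γ t ∈
      slashed I I.tangent.tangent (footpoint I (M := M)) := fun t ht => by
    have hev : footpoint I ∘ γ =ᶠ[𝓝 t] c := by
      filter_upwards [hJ.1.mem_nhds ht] with s hs' using hpγ s hs'
    rw [velocity_footpoint_mem_slashed_iff
      ((hγs.contMDiffAt (hJ.1.mem_nhds ht)).mdifferentiableAt (by simp)), velocity_congr hev]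
    exact hreg t ht
  refine ⟨hJ, hγs, hreg', fun t ht => ?_⟩
  have hc := LocalCoord.extChartAt (I := I) (c t)
  have hU : c t ∈ (extChartAt I (c t)).source := mem_extChartAt_source _
  have hr := hS.sprayRep hc
  set φ := extChartAt I (c t) with hφ
  have hUγ : footpoint I (γ t) ∈ φ.source := (hpγ t ht).symm ▸ hU
  rw [(hS.sprayRep_completeLift_completeLift hc).velocity_velocity_eq_iff hc.prolong.prolong hJ.1
    hγs ht ⟨hUγ, hreg' t ht⟩]
  have hvel : ∀ᶠ s in 𝓝 t, prolong I φ (velocity I c s) = ((φ ∘ c) s, deriv (φ ∘ c) s) ∧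
      (velocity I c s).proj ∈ φ.source ∧ velocity I c s ∈ slashed I I (id : M → M) := by
    filter_upwards [hloc t ht] with s hs'
    exact ⟨hc.prolong_velocity hJ.1 hs hs'.1 hs'.2.1, hs'.2.1, hreg s hs'.1⟩
  refine deriv_deriv_eq_liftRep_liftRep (u := φ ∘ c) (α := α) (β := β)
    (y := fun s => (prolong I φ (j s)).2) (hc.contDiffAt_comp hJ.1 hs ht hU) ?_ ?_ ?_ ?_ ?_
  · rw [← hvel.self_of_nhds.1]
    exact hr.contDiffAt _ hvel.self_of_nhds.2
  · filter_upwards [hloc t ht, hvel] with s h1 h2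
    exact (hr.velocity_velocity_eq_iff hc hJ.1 hs h1.1 h2.2).1 (heq s h1.1)
  · filter_upwards [hvel] with s h2
    have := hS.fderiv_force_eq hc h2.2
    rwa [h2.1] at this
  · filter_upwards [hloc t ht] with s h1
    rw [h1.2.2]
  · filter_upwards [(hloc t ht).eventually_nhds] with s h1
    have h2 := h1.self_of_nhds
    have hUj : (j s).proj ∈ φ.source := by rw [hj s h2.1]; exact h2.2.1
    have hUκ : (velocity I.tangent j s).proj.proj ∈ φ.source := hUj
    -- `j'` has entries `(u, y, u', y')`; `κ` reorders them into the `(u, u', y, y')` of the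
    -- coordinate computation.
    change prolong I.tangent (prolong I φ) (canonicalInvolution I (velocity I.tangent j s)) = _
    rw [prolong_prolong_canonicalInvolution hc.isOpen_source hc.contMDiffOn hUκ,
      hc.prolong.prolong_velocity hJ.1 hjs h2.1 hUj, h2.2.2]
    have hjd : DifferentiableAt ℝ (prolong I φ ∘ j) s :=
      (hc.prolong.contDiffAt_comp hJ.1 hjs h2.1 hUj).differentiableAt (by simp)
    have e1 : (deriv (prolong I φ ∘ j) s).1 = deriv (φ ∘ c) s := by
      rw [← deriv_fst hjd]
      refine EventuallyEq.deriv_eq ?_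
      filter_upwards [h1] with r hr'
      exact congrArg Prod.fst hr'.2.2
    have e2 : (deriv (prolong I φ ∘ j) s).2 = deriv (fun s => (prolong I φ (j s)).2) s :=
      (deriv_snd hjd).symm
    rw [swapMid_apply, e1, e2]

/-- Geodesics of the second complete lift are determined by one velocity. -/
theorem eqOn_of_isGeodesicOn_completeLift [T2Space M] (hS : IsSpray I S)
    {γ γ₁ : ℝ → TangentBundle I.tangent (TangentBundle I M)} {J : Set ℝ}
    (hγ : IsGeodesicOn I I.tangent.tangent (footpoint I)
      (completeLift I.tangent (completeLift I (toMap I S))) γ J)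
    (hγ₁ : IsGeodesicOn I I.tangent.tangent (footpoint I)
      (completeLift I.tangent (completeLift I (toMap I S))) γ₁ J) {t₀ : ℝ} (ht₀ : t₀ ∈ J)
    (h0 : velocity I.tangent.tangent γ t₀ = velocity I.tangent.tangent γ₁ t₀) :
    EqOn γ γ₁ J := by
  obtain ⟨hJ, hs, hreg, heq⟩ := hγ
  obtain ⟨-, hs₁, hreg₁, heq₁⟩ := hγ₁
  set A := {t | t ∈ J ∧ velocity I.tangent.tangent γ t = velocity I.tangent.tangent γ₁ t} with hA
  suffices h : J ⊆ A from fun t ht => congrArg TotalSpace.proj (h ht).2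
  -- Connectedness of `J`: the coincidence set of the velocities is open by local uniqueness,
  -- nonempty by `t₀`, and relatively closed in `J` by the Hausdorff property.
  refine (hJ.2.1.isPreconnected).subset_of_closure_inter_subset ?_ ⟨t₀, ht₀, ht₀, h0⟩ ?_
  · rw [isOpen_iff_mem_nhds]
    rintro t ⟨ht, hvt⟩
    have hγt : γ t = γ₁ t := congrArg TotalSpace.proj hvt
    have hc := LocalCoord.extChartAt (I := I) (footpoint I (γ t))
    have hU : footpoint I (γ t) ∈ (extChartAt I (footpoint I (γ t))).source :=
      mem_extChartAt_source _
    have hU₁ : footpoint I (γ₁ t) ∈ (extChartAt I (footpoint I (γ t))).source := hγt ▸ hU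
    set φ := extChartAt I (footpoint I (γ t)) with hφ
    have hc2 := hc.prolong.prolong
    have hr := hS.sprayRep_completeLift_completeLift hc
    have hp := hc2.prolong_velocity hJ.1 hs ht hU
    have hp₁ := hc2.prolong_velocity hJ.1 hs₁ ht hU₁
    have hpp := hp.symm.trans ((congrArg _ hvt).trans hp₁)
    have hev := eventually_mem_of_contMDiffOn hJ.1 hs ht (hc2.isOpen_source.mem_nhds hU)
    have hev₁ := eventually_mem_of_contMDiffOn hJ.1 hs₁ ht (hc2.isOpen_source.mem_nhds hU₁)
    have hloc := eventually_eq_of_deriv_deriv_eq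
      (u := prolong I.tangent (prolong I φ) ∘ γ) (v := prolong I.tangent (prolong I φ) ∘ γ₁)
      (F := liftRep (liftRep (force I S φ φ.symm))) (t := t)
      (hp ▸ hr.contDiffAt _ ⟨hU, hreg t ht⟩)
      (hc2.contDiffAt_comp hJ.1 hs ht hU) (hc2.contDiffAt_comp hJ.1 hs₁ ht hU₁)
      (hev.mono fun s h => (hr.velocity_velocity_eq_iff hc2 hJ.1 hs h.1
        ⟨h.2, hreg s h.1⟩).1 (heq s h.1))
      (hev₁.mono fun s h => (hr.velocity_velocity_eq_iff hc2 hJ.1 hs₁ h.1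
        ⟨h.2, hreg₁ s h.1⟩).1 (heq₁ s h.1))
      (congrArg Prod.fst hpp) (congrArg Prod.snd hpp)
    filter_upwards [hev, hev₁, hloc] with s h1 h2 h3
    refine ⟨h1.1, hc2.prolong.injOn h1.2 h2.2 ?_⟩
    rw [hc2.prolong_velocity hJ.1 hs h1.1 h1.2, hc2.prolong_velocity hJ.1 hs₁ h1.1 h2.2]
    exact Prod.ext h3.1 h3.2
  · rintro t ⟨hcl, ht⟩
    have hfr : ∃ᶠ s in 𝓝 t, velocity I.tangent.tangent γ s = velocity I.tangent.tangent γ₁ s :=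
      (mem_closure_iff_frequently.1 hcl).mono fun s h => h.2
    have hJt := hJ.1.mem_nhds ht
    -- Only `M` is assumed Hausdorff, so limits are first compared there. Equal footpoints put both
    -- velocities in one coordinate domain of `TTTM`, where limits are compared in a vector space.
    have hfoot : footpoint I (γ t) = footpoint I (γ₁ t) :=
      tendsto_nhds_unique_of_frequently_eq
        (contMDiff_footpoint.continuous.continuousAt.comp (hs.contMDiffAt hJt).continuousAt).tendsto
        (contMDiff_footpoint.continuous.continuousAt.comp
          (hs₁.contMDiffAt hJt).continuousAt).tendsto
        (hfr.mono fun s h => congrArg (fun ξ => footpoint I ξ.proj) h)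
    have hc := LocalCoord.extChartAt (I := I) (footpoint I (γ t))
    have hU : footpoint I (γ t) ∈ (extChartAt I (footpoint I (γ t))).source :=
      mem_extChartAt_source _
    have hU₁ : footpoint I (γ₁ t) ∈ (extChartAt I (footpoint I (γ t))).source := hfoot ▸ hU
    have hc3 := hc.prolong.prolong.prolong
    refine ⟨ht, hc3.injOn hU hU₁ ?_⟩
    exact tendsto_nhds_unique_of_frequently_eq
      (((hc3.contMDiffAt hU).continuousAt).comp
        ((contMDiffOn_velocity hJ.1 hs).contMDiffAt hJt).continuousAt).tendsto
      (((hc3.contMDiffAt hU₁).continuousAt).comp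
        ((contMDiffOn_velocity hJ.1 hs₁).contMDiffAt hJt).continuousAt).tendsto
      (hfr.mono fun s h => congrArg _ h)

end Geodesics

/-! ### Restriction and time translation of geodesics -/

section Shift

variable {E : Type*} [NormedAddCommGroup E] [NormedSpace ℝ E]
  {H : Type*} [TopologicalSpace H] {I : ModelWithCorners ℝ E H}
  {M : Type*} [TopologicalSpace M] [ChartedSpace H M]
  {E' : Type*} [NormedAddCommGroup E'] [NormedSpace ℝ E']
  {H' : Type*} [TopologicalSpace H'] {I' : ModelWithCorners ℝ E' H'}
  {N : Type*} [TopologicalSpace N] [ChartedSpace H' N] [IsManifold I' ∞ N]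
  {p : N → M} {S : TangentBundle I' N → TangentBundle I'.tangent (TangentBundle I' N)}
  {γ : ℝ → N}

theorem isOpenInterval_univ : IsOpenInterval univ :=
  ⟨isOpen_univ, ordConnected_univ, mem_univ _⟩

theorem IsGeodesicOn.mono {J J' : Set ℝ} (h : IsGeodesicOn I I' p S γ J)
    (hJ' : IsOpenInterval J') (hJJ' : J' ⊆ J) : IsGeodesicOn I I' p S γ J' :=
  ⟨hJ', h.2.1.mono hJJ', fun t ht => h.2.2.1 t (hJJ' ht), fun t ht => h.2.2.2 t (hJJ' ht)⟩

theorem IsGeodesicOn.comp_sub (h : IsGeodesicOn I I' p S γ univ) (a : ℝ) :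
    IsGeodesicOn I I' p S (fun t => γ (t - a)) univ := by
  obtain ⟨-, hs, hreg, heq⟩ := h
  have hs1 : ContMDiff 𝓘(ℝ, ℝ) I' ∞ γ := contMDiffOn_univ.1 hs
  have hs2 : ContMDiff 𝓘(ℝ, ℝ) I'.tangent ∞ (velocity I' γ) :=
    contMDiffOn_univ.1 (contMDiffOn_velocity isOpen_univ hs)
  have hv : velocity I' (fun t => γ (t - a)) = fun t => velocity I' γ (t - a) := funext fun t =>
    velocity_comp_sub γ (hs1.contMDiffAt.mdifferentiableAt (by simp))
  refine ⟨isOpenInterval_univ, contMDiffOn_univ.2 (hs1.comp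
    (contDiff_id.sub contDiff_const).contMDiff), fun t _ => ?_, fun t _ => ?_⟩
  · rw [hv]
    exact hreg _ (mem_univ _)
  · rw [hv, velocity_comp_sub _ (hs2.contMDiffAt.mdifferentiableAt (by simp))]
    exact heq _ (mem_univ _)

end Shift

/-! ### The two implications -/

section Main

variable {E : Type*} [NormedAddCommGroup E] [NormedSpace ℝ E] [CompleteSpace E]
  {H : Type*} [TopologicalSpace H] {I : ModelWithCorners ℝ E H} [I.Boundaryless]
  {M : Type*} [TopologicalSpace M] [ChartedSpace H M] [IsManifold I ∞ M]
  {S : (v : TangentBundle I M) → TangentSpace I.tangent v}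

theorem IsSpray.sprayIsComplete (hS : IsSpray I S) (h : ParallelSubSprayIsComplete I S) :
    SprayIsComplete I S := by
  rintro J c ⟨hc, -⟩
  -- The velocity of `c` is the parallel Jacobi field with `α = 1` and `β = 0`.
  have hj : ∀ t ∈ J, velocity I c t =
      (⟨c t, (1 : ℝ) • (velocity I c t).2 + ((0 : ℝ) * t) • (velocity I c t).2⟩ :
        TangentBundle I M) := fun t _ => by
    refine tangentBundle_ext rfl ?_
    have h2 : ∀ y : E, y = (1 : ℝ) • y + ((0 : ℝ) * t) • y := fun y => by simp
    exact h2 _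
  have hγ := IsParallelJacobiOn.isGeodesicOn hS hc hj
  have hJ := hc.1
  -- Elements of `Δ` come from symmetric intervals, so `c` is restricted to one; only the germ at
  -- `0` matters.
  obtain ⟨ε, hε, hεJ⟩ := Metric.isOpen_iff.1 hJ.1 0 hJ.2.2
  rw [Real.ball_eq_Ioo, zero_sub, zero_add] at hεJ
  have hΔ : velocity I.tangent.tangent
      (fun t => canonicalInvolution I (velocity I.tangent (velocity I c) t)) 0 ∈
        parallelSemiDistribution I S :=
    ⟨ε, velocity I c, hε, ⟨1, 0, c, hc.mono ⟨isOpen_Ioo, ordConnected_Ioo, by simp [hε]⟩ hεJ,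
      fun t ht => hj t (hεJ ht)⟩, rfl⟩
  obtain ⟨γ₁, ⟨hγ₁, -⟩, heq⟩ := h J _ ⟨hγ, 0, hJ.2.2, hΔ⟩
  refine ⟨footpoint I ∘ γ₁, ⟨hγ₁.footpoint_comp hS, 0, mem_univ _, mem_univ _⟩, fun t ht => ?_⟩
  exact congrArg (footpoint I) (heq ht)

theorem IsSpray.parallelSubSprayIsComplete [T2Space M] (hS : IsSpray I S)
    (h : SprayIsComplete I S) : ParallelSubSprayIsComplete I S := by
  rintro J γ ⟨hγ, t₀, ht₀, ε, j, hε, ⟨α, β, c, hc, hj⟩, hv⟩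
  obtain ⟨c₁, ⟨hc₁, -⟩, hcc⟩ := h _ c ⟨hc, 0, by simp [hε], mem_univ _⟩
  let j₁ : ℝ → TangentBundle I M := fun t =>
    ⟨c₁ t, α • (velocity I c₁ t).2 + (β * t) • (velocity I c₁ t).2⟩
  have hγ₁ := IsParallelJacobiOn.isGeodesicOn hS hc₁ (j := j₁) fun t _ => rfl
  set γ₁ := fun t => canonicalInvolution I (velocity I.tangent j₁ t) with hγ₁_def
  have hI : Ioo (-ε) ε ∈ 𝓝 (0 : ℝ) := Ioo_mem_nhds (by linarith) hε
  have hjj : ∀ᶠ t in 𝓝 (0 : ℝ), j t = j₁ t := by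
    filter_upwards [hI] with t ht
    have hcv : velocity I c t = velocity I c₁ t := velocity_congr (by
      filter_upwards [isOpen_Ioo.mem_nhds ht] with s hs using (hcc hs).symm)
    rw [hj t ht]
    refine tangentBundle_ext (hcc ht).symm ?_
    exact congrArg (fun w : TangentBundle I M => (α • (w.2 : E) + (β * t) • (w.2 : E) : E)) hcv
  have hvel : velocity I.tangent.tangent γ₁ 0 = velocity I.tangent.tangent γ t₀ := by
    rw [← hv]
    refine velocity_congr ?_
    filter_upwards [velocity_eventuallyEq (I := I.tangent) hjj] with t ht
    exact congrArg (canonicalInvolution I) ht.symm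
  -- `Δ` records velocities at time `0`, whereas `γ` meets `Δ` at time `t₀`.
  have hγ₂ := hγ₁.comp_sub t₀
  have hvel₂ : velocity I.tangent.tangent (fun t => γ₁ (t - t₀)) t₀ =
      velocity I.tangent.tangent γ₁ 0 := by
    have hs1 := contMDiffOn_univ.1 hγ₁.2.1
    rw [velocity_comp_sub _ (hs1.contMDiffAt.mdifferentiableAt (by simp)), sub_self]
  refine ⟨fun t => γ₁ (t - t₀), ⟨hγ₂, t₀, mem_univ _, ?_⟩, ?_⟩
  -- The extension has the velocity of `γ` at `t₀`, so the original `j` and `c` witness membership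
  -- in `Δ`.
  · rw [hvel₂, hvel]
    exact ⟨ε, j, hε, ⟨α, β, c, hc, hj⟩, hv⟩
  · exact eqOn_of_isGeodesicOn_completeLift hS (hγ₂.mono hγ.1 (subset_univ _)) hγ ht₀
      (hvel₂.trans hvel)

end Main

end SprayGeometry

theorem mainTheorem4
    {E : Type*} [NormedAddCommGroup E] [NormedSpace ℝ E] [FiniteDimensional ℝ E]
    (hdim : 1 ≤ Module.finrank ℝ E)
    {M : Type*} [TopologicalSpace M] [T2Space M] [SecondCountableTopology M]
    [ChartedSpace E M] [IsManifold 𝓘(ℝ, E) ∞ M]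
    (S : (v : TangentBundle 𝓘(ℝ, E) M) → TangentSpace 𝓘(ℝ, E).tangent v)
    (hS : SprayGeometry.IsSpray 𝓘(ℝ, E) S) :
    SprayGeometry.ParallelSubSprayIsComplete 𝓘(ℝ, E) S ↔
      SprayGeometry.SprayIsComplete 𝓘(ℝ, E) S := by
  have : CompleteSpace E := FiniteDimensional.complete ℝ E
  exact ⟨hS.sprayIsComplete, hS.parallelSubSprayIsComplete⟩
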